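/- For a probability measure $\mu$ on $\mathbb R$ let $G_\mu(z)=\int_{\mathbb R}\frac{1}{z-x}\,d\mu(x)$ be its Cauchy transform and $H_\mu(z)=1/G_\mu(z)$ its reciprocal Cauchy transform, $z\in\mathbb C\setminus\mathbb R$. Call a pair of families $(H_t)_{t\ge0}$, $(F_t)_{t\ge0}$ of functions on $\mathbb C\setminus\mathbb R$ a continuous c-monotone semigroup if every $H_t$ and every $F_t$ is the reciprocal Cauchy transform of some probability measure on $\mathbb R$; $H_0(z)=F_0(z)=z$; for each fixed $z\in\mathbb C\setminus\mathbb R$ the maps $t\mapsto H_t(z)$ and $t\mapsto F_t(z)$ are continuous on $[0,\infty)$; and for all $s,t\ge0$, on $\mathbb C\setminus\mathbb R$, $$F_{t+s}=F_t\circ F_s,\qquad H_{t+s}=H_t\circ F_s-F_s+H_s .$$ Say that $A$ has Lévy–Khintchine form if there are $\gamma\in\mathbb R$ and a finite positive measure $\tau$ on $\mathbb R$ with $$A(z)=-\gamma+\int_{\mathbb R}\frac{1+xz}{x-z}\,d\tau(x),\qquad z\in\mathbb C\setminus\mathbb R .$$ (1) Let $(H_t,F_t)_{t\ge0}$ be a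 continuous c-monotone semigroup. Then there are analytic functions (vector fields) $A_1,A_2$ on $\mathbb C\setminus\mathbb R$ such that for all $z\in\mathbb C\setminus\mathbb R$ and $t\ge0$ the functions $t\mapsto H_t(z)$ and $t\mapsto F_t(z)$ are differentiable (from the right at $t=0$) with $$\frac{d}{dt}H_t(z)=A_1(F_t(z)),\qquad \frac{d}{dt}F_t(z)=A_2(F_t(z)).\tag{$*$}$$ In particular $A_1(z)=\frac{d}{dt}\big|_{t=0}H_t(z)$ and $A_2(z)=\frac{d}{dt}\big|_{t=0}F_t(z)$. Moreover $A_1$ and $A_2$ both have Lévy–Khintchine form. (2) Conversely, let $A_1,A_2$ have Lévy–Khintchine form. Then there is a continuous c-monotone semigroup $(H_t,F_t)_{t\ge0}$ satisfying $(*)$ for all $z\in\mathbb C\setminus\mathbb R$, $t\ge0$, and such that $(t,z)\mapsto H_t(z)$ and $(t,z)\mapsto F_t(z)$ are real-analytic ($C^\omega$) on $[0,\infty)\times(\mathbb C\setminus\mathbb R)$. It is determined by the equations: for each $z\in\mathbb C\setminus\mathbb R$, if $f:[0,\infty)\to\mathbb C\setminus\mathbb R$ and $h:[0,\infty)\to\mathbb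 C$ satisfy $h'=A_1(f)$, $f'=A_2(f)$ and $h(0)=f(0)=z$, then $h(t)=H_t(z)$ and $f(t)=F_t(z)$ for all $t\ge0$. -/

import Mathlib

open MeasureTheory

noncomputable section

namespace CMonotone

/-- The set `ℂ \ ℝ` of non-real complex numbers. -/
def offReal : Set ℂ := {z : ℂ | z.im ≠ 0}

/-- The Cauchy transform `G_μ(z) = ∫ 1 / (z - x) dμ(x)`, used for `z ∈ ℂ \ ℝ`. -/
def cauchyTransform (μ : Measure ℝ) (z : ℂ) : ℂ :=
  ∫ x : ℝ, 1 / (z - (x : ℂ)) ∂μ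

/-- The reciprocal Cauchy transform `H_μ(z) = 1 / G_μ(z)`, used for `z ∈ ℂ \ ℝ`. -/
def reciprocalCauchyTransform (μ : Measure ℝ) (z : ℂ) : ℂ :=
  1 / cauchyTransform μ z

/-- `K` is, on `ℂ \ ℝ`, the reciprocal Cauchy transform of a probability measure on `ℝ`. -/
def IsReciprocalCauchyTransform (K : ℂ → ℂ) : Prop :=
  ∃ μ : Measure ℝ, IsProbabilityMeasure μ ∧
    ∀ z ∈ offReal, K z = reciprocalCauchyTransform μ z

/-- The families `(H_t)` and `(F_t)`, `t ≥ 0`, of reciprocal Cauchy transforms start at the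
identity, are continuous in `t` for each fixed `z ∈ ℂ \ ℝ`, and satisfy `F_{t+s} = F_t ∘ F_s` and
`H_{t+s} = H_t ∘ F_s - F_s + H_s`. Values at `t < 0` or at real `z` are irrelevant. -/
structure IsCMonotoneSemigroup (H F : ℝ → ℂ → ℂ) : Prop where
  isReciprocal_right : ∀ t : ℝ, 0 ≤ t → IsReciprocalCauchyTransform (F t)
  isReciprocal_left : ∀ t : ℝ, 0 ≤ t → IsReciprocalCauchyTransform (H t)
  zero_right : ∀ z ∈ offReal, F 0 z = z
  zero_left : ∀ z ∈ offReal, H 0 z = z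
  continuous_right : ∀ z ∈ offReal, ContinuousOn (fun t : ℝ => F t z) (Set.Ici 0)
  continuous_left : ∀ z ∈ offReal, ContinuousOn (fun t : ℝ => H t z) (Set.Ici 0)
  add_right : ∀ t s : ℝ, 0 ≤ t → 0 ≤ s → ∀ z ∈ offReal, F (t + s) z = F t (F s z)
  add_left : ∀ t s : ℝ, 0 ≤ t → 0 ≤ s → ∀ z ∈ offReal,
    H (t + s) z = H t (F s z) - F s z + H s z

/-- `A(z) = -γ + ∫ (1 + x z) / (x - z) dτ(x)` on `ℂ \ ℝ`, for some real `γ` and some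
finite positive measure `τ` on `ℝ`. -/
def HasLevyKhintchineForm (A : ℂ → ℂ) : Prop :=
  ∃ (γ : ℝ) (τ : Measure ℝ), IsFiniteMeasure τ ∧
    ∀ z ∈ offReal, A z = -(γ : ℂ) + ∫ x : ℝ, (1 + (x : ℂ) * z) / ((x : ℂ) - z) ∂τ

/-- The curve `(h, f)` solves `dh/dt = A₁(f)`, `df/dt = A₂(f)` on `[0, ∞)` (with the one-sided
derivative at `t = 0`), and `f` stays in the domain `ℂ \ ℝ` of the vector fields. -/
def SolvesFlow (A₁ A₂ : ℂ → ℂ) (h f : ℝ → ℂ) : Prop :=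
  ∀ t : ℝ, 0 ≤ t → f t ∈ offReal ∧
    HasDerivWithinAt h (A₁ (f t)) (Set.Ici 0) t ∧
    HasDerivWithinAt f (A₂ (f t)) (Set.Ici 0) t

end CMonotone

end

noncomputable section

namespace CMonotone

open Complex Filter Topology Set
open scoped ComplexConjugate NNReal

/-! Everything rests on Pick functions, taken here as a real constant plus an integral of the
Herglotz kernel against a finite measure on the unit circle. The total mass is Im g(i) and the
circle is compact, so Pick functions are closed under pointwise limits (`IsPick.of_tendsto`) and
locally Lipschitz with constant proportional to Im g(i) (`IsPick.norm_sub_le`). Lévy–Khintchine form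
means: Pick without a linear term. Reciprocal Cauchy transforms are the symmetric holomorphic K with
Im K(z) ≥ Im z on the upper half-plane and K(iy)/(iy) → 1 (`isReciprocalCauchyTransform_of`); in
particular K(z) - z is Pick.

From semigroup to generators: k_t = F_t - id and k_t = H_t - id both satisfy k_{t+s} = k_t ∘ F_s +
k_s. Averaging this relation in time compares k_t/t with k_s/s up to an error ε + Cε|F_t(z) - z|/t
(`exists_slope_estimate`). For k = F - id the error is absorbed, so these slopes are bounded; then
all slopes are Cauchy as t → 0. The limit A is Pick, the cocycle relation carries the derivative to
every time, and a linear term bz with b > 0 in A would give Im k_1(iy) ≥ by, against K(iy)/(iy) → 1.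

From generators to semigroup: on the upper half-plane A₂ is either zero-free or identically 0, and
the second case is explicit. In the first, a primitive Ψ of 1/A₂ is injective and straightens the
flow: F_t = Ψ⁻¹(Ψ + t) and H_t = id + Θ ∘ F_t - Θ with Θ' = A₁/A₂. The flow is global because, by
Schwarz–Pick, the hyperbolic speed of an integral curve does not increase, which confines it to a
compact set in bounded time (`IsPick.integralCurve_bound`, `add_mem_image`). Lévy–Khintchine form
makes A₁ and A₂ sublinear near the imaginary axis, which yields the condition at infinity.
Reflection handles the lower half-plane. -/

instance : MeasurableSpace Circle := borel Circle

instance : BorelSpace Circle := ⟨rfl⟩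

/-! ### Herglotz kernels and Pick functions -/

/-- The Möbius denominator `ζ (z + i) - (z - i)`. -/
def pickDenom (ζ z : ℂ) : ℂ := ζ * (z + I) - (z - I)

/-- The Herglotz kernel of the unit circle, transported to the half-planes. -/
def pickKernel (ζ z : ℂ) : ℂ := I * (ζ * (z + I) + (z - I)) / pickDenom ζ z

/-- A lower bound for `‖pickDenom ζ z‖` on the unit circle. -/
def pickGap (z : ℂ) : ℝ := |‖z + I‖ - ‖z - I‖|

/-- `g` is, on `ℂ \ ℝ`, an integral of Herglotz kernels plus a real constant. -/
def IsPick (g : ℂ → ℂ) : Prop :=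
  ∃ (γ : ℝ) (ν : FiniteMeasure Circle), ∀ z ∈ offReal,
    g z = γ + ∫ ζ : Circle, pickKernel ζ z ∂(ν : Measure Circle)

lemma isOpen_offReal : IsOpen offReal :=
  (isClosed_eq Complex.continuous_im continuous_const).isOpen_compl

lemma conj_mem_offReal {z : ℂ} (hz : z ∈ offReal) : conj z ∈ offReal := by
  simpa [offReal] using hz

lemma I_mem_offReal : I ∈ offReal := by simp [offReal]

lemma mem_offReal_of_pos {z : ℂ} (hz : 0 < z.im) : z ∈ offReal := hz.ne'

lemma norm_add_I_sq_sub (z : ℂ) : ‖z + I‖ ^ 2 - ‖z - I‖ ^ 2 = 4 * z.im := by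
  rw [← normSq_eq_norm_sq, ← normSq_eq_norm_sq]
  simp [normSq_apply]
  ring

/-- The points equidistant from i and -i form exactly the real axis. -/
lemma pickGap_pos {z : ℂ} (hz : z ∈ offReal) : 0 < pickGap z := by
  refine abs_pos.2 fun h => hz ?_
  have := norm_add_I_sq_sub z
  rw [sub_eq_zero.1 h] at this
  linarith

lemma continuous_pickGap : Continuous pickGap := by
  unfold pickGap
  fun_prop

lemma pickGap_le (ζ : Circle) (z : ℂ) : pickGap z ≤ ‖pickDenom ζ z‖ := by
  have := abs_norm_sub_norm_le ((ζ : ℂ) * (z + I)) (z - I)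
  rwa [norm_mul, Circle.norm_coe, one_mul] at this

lemma pickDenom_ne_zero (ζ : Circle) {z : ℂ} (hz : z ∈ offReal) : pickDenom ζ z ≠ 0 :=
  norm_pos_iff.1 ((pickGap_pos hz).trans_le (pickGap_le ζ z))

lemma continuous_pickKernel {z : ℂ} (hz : z ∈ offReal) :
    Continuous fun ζ : Circle => pickKernel ζ z := by
  unfold pickKernel
  refine Continuous.div ?_ ?_ fun ζ => pickDenom_ne_zero ζ hz
  · fun_prop
  · unfold pickDenom
    fun_prop

lemma integrable_pickKernel {z : ℂ} (hz : z ∈ offReal) (ν : Measure Circle) [IsFiniteMeasure ν] :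
    Integrable (fun ζ : Circle => pickKernel ζ z) ν :=
  (continuous_pickKernel hz).integrable_of_hasCompactSupport (.of_compactSpace _)

lemma pickKernel_I (ζ : Circle) : pickKernel ζ I = I := by
  have h := pickDenom_ne_zero ζ I_mem_offReal
  rw [pickKernel, div_eq_iff h, pickDenom]
  ring

/-- The kernel is a Möbius map, so its differences factor. This gives the Lipschitz bound and, with
w = conj z, the imaginary part. -/
lemma pickKernel_sub (ζ : Circle) {z w : ℂ} (hz : z ∈ offReal) (hw : w ∈ offReal) :
    pickKernel ζ z - pickKernel ζ w = -4 * ζ * (z - w) / (pickDenom ζ z * pickDenom ζ w) := by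
  have h1 := pickDenom_ne_zero ζ hz
  have h2 := pickDenom_ne_zero ζ hw
  rw [pickKernel, pickKernel, div_sub_div _ _ h1 h2]
  congr 1
  simp only [pickDenom]
  linear_combination (4 * ζ * (z - w)) * I_sq

lemma norm_pickKernel_sub_le (ζ : Circle) {z w : ℂ} (hz : z ∈ offReal) (hw : w ∈ offReal) :
    ‖pickKernel ζ z - pickKernel ζ w‖ ≤ 4 / (pickGap z * pickGap w) * ‖z - w‖ := by
  have h1 := pickGap_pos hz
  have h2 := pickGap_pos hw
  rw [pickKernel_sub ζ hz hw, norm_div, norm_mul, norm_mul, norm_mul, norm_neg, Circle.norm_coe,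
    div_mul_eq_mul_div]
  have := mul_le_mul (pickGap_le ζ z) (pickGap_le ζ w) h2.le (norm_nonneg _)
  rw [mul_one]
  simp only [Complex.norm_ofNat]
  gcongr

lemma conj_pickKernel (ζ : Circle) {z : ℂ} (hz : z ∈ offReal) :
    conj (pickKernel ζ z) = pickKernel ζ (conj z) := by
  have h1 := pickDenom_ne_zero ζ (conj_mem_offReal hz)
  have h2 := (map_ne_zero (starRingEnd ℂ)).2 (pickDenom_ne_zero ζ hz)
  have hζ : (ζ : ℂ) * conj (ζ : ℂ) = 1 := by
    rw [mul_conj, Circle.normSq_coe, ofReal_one]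
  rw [pickKernel, pickKernel, map_div₀, div_eq_div_iff h2 h1]
  simp only [pickDenom, map_mul, map_add, map_sub, conj_I]
  linear_combination (-2 * I * ((conj z + I) * (conj z - I))) * hζ

lemma pickKernel_im (ζ : Circle) {z : ℂ} (hz : z ∈ offReal) :
    (pickKernel ζ z).im = 4 * z.im / ‖pickDenom ζ z‖ ^ 2 := by
  have hD := pickDenom_ne_zero ζ hz
  have hζ : (ζ : ℂ) * conj (ζ : ℂ) = 1 := by
    rw [mul_conj, Circle.normSq_coe, ofReal_one]
  have hbar : pickDenom ζ (conj z) = -ζ * conj (pickDenom ζ z) := by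
    simp only [pickDenom, map_mul, map_add, map_sub, conj_I]
    linear_combination (conj z - I) * hζ
  have h := pickKernel_sub ζ hz (conj_mem_offReal hz)
  rw [← conj_pickKernel ζ hz, sub_conj, sub_conj, hbar] at h
  have hn : pickDenom ζ z * conj (pickDenom ζ z) = ((‖pickDenom ζ z‖ ^ 2 : ℝ) : ℂ) := by
    rw [mul_conj, normSq_eq_norm_sq]
  have hζ0 : (ζ : ℂ) ≠ 0 := ζ.coe_ne_zero
  have hn0 : ((‖pickDenom ζ z‖ ^ 2 : ℝ) : ℂ) ≠ 0 := by
    exact_mod_cast pow_ne_zero 2 (norm_ne_zero_iff.2 hD)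
  rw [show pickDenom ζ z * (-ζ * conj (pickDenom ζ z)) =
    -ζ * (pickDenom ζ z * conj (pickDenom ζ z)) by ring, hn] at h
  have h2 : ((pickKernel ζ z).im : ℂ) = ((4 * z.im / ‖pickDenom ζ z‖ ^ 2 : ℝ) : ℂ) := by
    rw [ofReal_div, eq_div_iff hn0]
    rw [eq_div_iff (mul_ne_zero (neg_ne_zero.2 hζ0) hn0)] at h
    have : (2 * I * ζ) * (((pickKernel ζ z).im : ℂ) * ((‖pickDenom ζ z‖ ^ 2 : ℝ) : ℂ)) =
        (2 * I * ζ) * (4 * z.im) := by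
      push_cast at h ⊢
      linear_combination -h
    have := mul_left_cancel₀ (mul_ne_zero (mul_ne_zero two_ne_zero I_ne_zero) hζ0) this
    rw [this]
    push_cast
    ring
  exact_mod_cast h2

lemma hasDerivAt_pickKernel (ζ : Circle) {z : ℂ} (hz : z ∈ offReal) :
    HasDerivAt (pickKernel ζ) (-4 * ζ / pickDenom ζ z ^ 2) z := by
  have hD := pickDenom_ne_zero ζ hz
  have h1 : HasDerivAt (pickDenom ζ) (ζ * 1 - 1) z :=
    (((hasDerivAt_id z).add_const I).const_mul (ζ : ℂ)).sub ((hasDerivAt_id z).sub_const I)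
  have h2 : HasDerivAt (fun z => I * (ζ * (z + I) + (z - I))) (I * (ζ * 1 + 1)) z :=
    ((((hasDerivAt_id z).add_const I).const_mul (ζ : ℂ)).add
      ((hasDerivAt_id z).sub_const I)).const_mul I
  refine (h2.div h1 hD).congr_deriv ?_
  congr 1
  simp only [pickDenom]
  linear_combination (4 * ζ : ℂ) * I_sq

lemma integral_pickKernel_I (ν : FiniteMeasure Circle) :
    ∫ ζ : Circle, pickKernel ζ I ∂(ν : Measure Circle) = (ν.mass : ℂ) * I := by
  simp only [pickKernel_I, integral_const, Measure.real, real_smul]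
  congr 1

lemma integral_pickKernel_im {z : ℂ} (hz : z ∈ offReal) (ν : FiniteMeasure Circle) :
    (∫ ζ : Circle, pickKernel ζ z ∂(ν : Measure Circle)).im =
      ∫ ζ : Circle, 4 * z.im / ‖pickDenom ζ z‖ ^ 2 ∂(ν : Measure Circle) := by
  have := integral_im (𝕜 := ℂ) (integrable_pickKernel hz (ν : Measure Circle))
  simp only [RCLike.im_to_complex] at this
  rw [← this]
  simp only [pickKernel_im _ hz]

lemma hasDerivAt_integral_pickKernel {z : ℂ} (hz : z ∈ offReal) (ν : FiniteMeasure Circle) :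
    HasDerivAt (fun w => ∫ ζ : Circle, pickKernel ζ w ∂(ν : Measure Circle))
      (∫ ζ : Circle, -4 * (ζ : ℂ) / pickDenom ζ z ^ 2 ∂(ν : Measure Circle)) z := by
  have hpos := pickGap_pos hz
  have hnhds : {w | pickGap z / 2 < pickGap w} ∩ offReal ∈ 𝓝 z :=
    inter_mem (continuous_pickGap.continuousAt.eventually (lt_mem_nhds (half_lt_self hpos)))
      (isOpen_offReal.mem_nhds hz)
  obtain ⟨ε, hε, hball⟩ := Metric.mem_nhds_iff.1 hnhds
  refine (hasDerivAt_integral_of_dominated_loc_of_deriv_le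
    (F := fun w (ζ : Circle) => pickKernel ζ w)
    (F' := fun w (ζ : Circle) => -4 * (ζ : ℂ) / pickDenom ζ w ^ 2)
    (bound := fun _ => 4 / (pickGap z / 2) ^ 2) (Metric.ball_mem_nhds z hε) ?_
    (integrable_pickKernel hz _) ?_ ?_ (integrable_const _) ?_).2
  · filter_upwards [isOpen_offReal.mem_nhds hz] with w hw
    exact (integrable_pickKernel hw _).aestronglyMeasurable
  · refine Continuous.aestronglyMeasurable (Continuous.div (by fun_prop) ?_
      fun ζ => pow_ne_zero 2 (pickDenom_ne_zero ζ hz))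
    unfold pickDenom
    fun_prop
  · refine Eventually.of_forall fun ζ w hw => ?_
    have h1 := (hball hw).1
    have h2 := pickGap_le ζ w
    rw [norm_div, norm_mul, norm_neg, Circle.norm_coe, norm_pow, mul_one]
    simp only [Complex.norm_ofNat]
    have : pickGap z / 2 ≤ ‖pickDenom ζ w‖ := h1.le.trans h2
    gcongr
  · exact Eventually.of_forall fun ζ w hw => hasDerivAt_pickKernel ζ (hball hw).2

lemma IsPick.differentiableOn {g : ℂ → ℂ} (hg : IsPick g) : DifferentiableOn ℂ g offReal := by
  obtain ⟨γ, ν, h⟩ := hg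
  refine DifferentiableOn.congr (fun z hz => ?_) h
  exact ((hasDerivAt_integral_pickKernel hz ν).differentiableAt.const_add
    (γ : ℂ)).differentiableWithinAt

lemma IsPick.im_nonneg {g : ℂ → ℂ} (hg : IsPick g) {z : ℂ} (hz : 0 < z.im) : 0 ≤ (g z).im := by
  obtain ⟨γ, ν, h⟩ := hg
  rw [h z (mem_offReal_of_pos hz), add_im, ofReal_im, zero_add,
    integral_pickKernel_im (mem_offReal_of_pos hz)]
  exact integral_nonneg fun ζ => by positivity

lemma IsPick.conj_apply {g : ℂ → ℂ} (hg : IsPick g) {z : ℂ} (hz : z ∈ offReal) :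
    g (conj z) = conj (g z) := by
  obtain ⟨γ, ν, h⟩ := hg
  rw [h z hz, h _ (conj_mem_offReal hz), map_add, conj_ofReal, ← integral_conj]
  simp only [conj_pickKernel _ hz]

/-- The infinitesimal Schwarz–Pick inequality. -/
lemma IsPick.norm_deriv_le {g : ℂ → ℂ} (hg : IsPick g) {z : ℂ} (hz : 0 < z.im) :
    ‖deriv g z‖ ≤ (g z).im / z.im := by
  obtain ⟨γ, ν, h⟩ := hg
  have hz' := mem_offReal_of_pos hz
  have hd : HasDerivAt g
      (∫ ζ : Circle, -4 * (ζ : ℂ) / pickDenom ζ z ^ 2 ∂(ν : Measure Circle)) z := by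
    refine ((hasDerivAt_integral_pickKernel hz' ν).const_add (γ : ℂ)).congr_of_eventuallyEq ?_
    filter_upwards [isOpen_offReal.mem_nhds hz'] with w hw using h w hw
  rw [hd.deriv, h z hz', add_im, ofReal_im, zero_add, integral_pickKernel_im hz',
    le_div_iff₀ hz]
  -- The z-derivative of the kernel has norm 4/|D|², with D the denominator: exactly its imaginary
  -- part divided by Im z.
  simp only [mul_div_right_comm _ z.im, integral_mul_const]
  gcongr
  refine (norm_integral_le_integral_norm _).trans (le_of_eq ?_)
  congr 1
  ext ζ
  rw [norm_div, norm_mul, norm_neg, Circle.norm_coe, norm_pow, mul_one, Complex.norm_ofNat]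

/-- Pick functions are locally Lipschitz, with constants controlled by the value at `i`. -/
lemma IsPick.norm_sub_le {g : ℂ → ℂ} (hg : IsPick g) {z w : ℂ} (hz : z ∈ offReal)
    (hw : w ∈ offReal) :
    ‖g z - g w‖ ≤ 4 / (pickGap z * pickGap w) * ‖z - w‖ * (g I).im := by
  obtain ⟨γ, ν, h⟩ := hg
  have hI : (g I).im = ν.mass := by
    rw [h I I_mem_offReal, integral_pickKernel_I]
    simp
  rw [hI, h z hz, h w hw, add_sub_add_left_eq_sub,
    ← integral_sub (integrable_pickKernel hz _) (integrable_pickKernel hw _)]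
  refine (norm_integral_le_of_norm_le_const (Eventually.of_forall fun ζ =>
    norm_pickKernel_sub_le ζ hz hw)).trans (le_of_eq ?_)
  rfl

/-- Pick functions are closed under pointwise limits. -/
lemma IsPick.of_tendsto {ι : Type*} {l : Filter ι} [l.NeBot] {g : ι → ℂ → ℂ} {G : ℂ → ℂ}
    (hg : ∀ᶠ i in l, IsPick (g i)) (hG : ∀ z ∈ offReal, Tendsto (fun i => g i z) l (𝓝 (G z))) :
    IsPick G := by
  have : ∀ i, ∃ (γ : ℝ) (ν : FiniteMeasure Circle), IsPick (g i) → ∀ z ∈ offReal,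
      g i z = γ + ∫ ζ : Circle, pickKernel ζ z ∂(ν : Measure Circle) := fun i => by
    by_cases h : IsPick (g i)
    · obtain ⟨γ, ν, h'⟩ := h
      exact ⟨γ, ν, fun _ => h'⟩
    · exact ⟨0, 0, fun h' => absurd h' h⟩
  choose γ ν hν using this
  -- The mass of `ν i` is Im g_i(i), which converges, so the masses are eventually bounded.
  set C : ℝ≥0 := ((G I).im + 1).toNNReal
  have hI := hG I I_mem_offReal
  have hmass : ∀ᶠ i in l, (ν i).mass ≤ C := by
    have h1 := (Complex.continuous_im.tendsto _).comp hI
    filter_upwards [hg, h1.eventually (gt_mem_nhds (lt_add_one _))] with i hi h2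
    have h3 : ((g i I).im : ℝ) = (ν i).mass := by
      rw [hν i hi I I_mem_offReal, integral_pickKernel_I]
      simp
    rw [Function.comp_apply, h3] at h2
    exact NNReal.le_toNNReal_of_coe_le h2.le
  have hγ : Tendsto γ l (𝓝 (G I).re) := by
    refine ((Complex.continuous_re.tendsto _).comp hI).congr' ?_
    filter_upwards [hg] with i hi
    rw [Function.comp_apply, hν i hi I I_mem_offReal, integral_pickKernel_I]
    simp
  -- A finer ultrafilter replaces the extraction of a subsequence; it works for an arbitrary `l`.
  let U : Ultrafilter ι := Ultrafilter.of l
  have hU : (U : Filter ι) ≤ l := Ultrafilter.of_le l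
  obtain ⟨ν₀, -, hν₀⟩ :=
    (isCompact_setOfPred_finiteMeasure_le_of_compactSpace Circle C).ultrafilter_le_nhds
    (U.map ν) (by
      rw [le_principal_iff]
      exact hU hmass)
  have hν₀' : Tendsto ν U (𝓝 ν₀) := hν₀
  rw [FiniteMeasure.tendsto_iff_forall_integral_rclike_tendsto ℂ] at hν₀'
  refine ⟨(G I).re, ν₀, fun z hz => ?_⟩
  refine tendsto_nhds_unique ((hG z hz).mono_left hU) ?_
  have h1 := hν₀' (BoundedContinuousFunction.mkOfCompact ⟨_, continuous_pickKernel hz⟩)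
  have h2 := ((Complex.continuous_ofReal.tendsto _).comp (hγ.mono_left hU)).add h1
  refine h2.congr' ?_
  filter_upwards [hU hg] with i hi
  exact (hν i hi z hz).symm

lemma IsPick.smul {g : ℂ → ℂ} (hg : IsPick g) (c : ℝ≥0) : IsPick fun z => (c : ℂ) * g z := by
  obtain ⟨γ, ν, h⟩ := hg
  refine ⟨c * γ, c • ν, fun z hz => ?_⟩
  beta_reduce
  rw [h z hz, FiniteMeasure.toMeasure_smul, integral_smul_nnreal_measure, mul_add]
  simp [NNReal.smul_def]

/-! ### Passage from the circle to the real line -/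

/-- The Lévy–Khintchine kernel `(1 + x z) / (x - z)`. -/
def lkKernel (x : ℝ) (z : ℂ) : ℂ := (1 + (x : ℂ) * z) / ((x : ℂ) - z)

lemma ofReal_sub_ne_zero (x : ℝ) {z : ℂ} (hz : z ∈ offReal) : (x : ℂ) - z ≠ 0 := by
  intro h
  apply hz
  rw [← sub_eq_zero.1 h, ofReal_im]

lemma ofReal_add_I_ne_zero (x : ℝ) : (x : ℂ) + I ≠ 0 := by
  intro h
  simpa using congrArg Complex.im h

lemma continuous_coe_circle : Continuous fun ζ : Circle => (ζ : ℂ) := by fun_prop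

/-- The Cayley transform from the real line to the circle. -/
def cayleyCircle (x : ℝ) : Circle := Circle.ofConjDivSelf (x + I) (ofReal_add_I_ne_zero x)

lemma coe_cayleyCircle (x : ℝ) : (cayleyCircle x : ℂ) = (x - I) / (x + I) := by
  simp [cayleyCircle, sub_eq_add_neg]

lemma continuous_cayleyCircle : Continuous cayleyCircle := by
  refine continuous_induced_rng.2 ?_
  refine Continuous.congr (f := fun x : ℝ => ((x : ℂ) - I) / (x + I)) ?_
    fun x => (coe_cayleyCircle x).symm
  exact Continuous.div (by fun_prop) (by fun_prop) ofReal_add_I_ne_zero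

lemma pickKernel_cayleyCircle (x : ℝ) {z : ℂ} (hz : z ∈ offReal) :
    pickKernel (cayleyCircle x) z = lkKernel x z := by
  have h1 := pickDenom_ne_zero (cayleyCircle x) hz
  have h2 := ofReal_sub_ne_zero x hz
  have h3 := ofReal_add_I_ne_zero x
  have h4 : (cayleyCircle x : ℂ) * (x + I) = x - I := by
    rw [coe_cayleyCircle, div_mul_cancel₀ _ h3]
  rw [pickKernel, lkKernel, div_eq_div_iff h1 h2]
  refine mul_right_cancel₀ h3 ?_
  simp only [pickDenom]
  linear_combination (I * (z + I) * (x - z) - (1 + x * z) * (z + I)) * h4 +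
    (2 * I * (z - x)) * I_sq

lemma integrable_lkKernel {z : ℂ} (hz : z ∈ offReal) (τ : Measure ℝ) [IsFiniteMeasure τ] :
    Integrable (fun x => lkKernel x z) τ := by
  have := (integrable_map_measure (μ := τ) (f := cayleyCircle) (g := fun ζ => pickKernel ζ z)
    (continuous_pickKernel hz).aestronglyMeasurable continuous_cayleyCircle.aemeasurable).1
    (integrable_pickKernel hz _)
  exact this.congr (Eventually.of_forall fun x => pickKernel_cayleyCircle x hz)

lemma isPick_of_integral_lkKernel {A : ℂ → ℂ} (γ : ℝ) (τ : Measure ℝ) [IsFiniteMeasure τ]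
    (h : ∀ z ∈ offReal, A z = γ + ∫ x, lkKernel x z ∂τ) : IsPick A := by
  refine ⟨γ, ⟨τ.map cayleyCircle, inferInstance⟩, fun z hz => ?_⟩
  rw [h z hz, FiniteMeasure.toMeasure_mk,
    integral_map continuous_cayleyCircle.aemeasurable
      (continuous_pickKernel hz).aestronglyMeasurable]
  simp only [pickKernel_cayleyCircle _ hz]

lemma HasLevyKhintchineForm.isPick {A : ℂ → ℂ} (hA : HasLevyKhintchineForm A) : IsPick A := by
  obtain ⟨γ, τ, hτ, h⟩ := hA
  refine isPick_of_integral_lkKernel (-γ) τ fun z hz => ?_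
  rw [h z hz, ofReal_neg]
  rfl

/-- The real coordinate on the circle without `1`. -/
def circleCoord (ζ : Circle) : ℝ := (I * (1 + ζ) / (1 - ζ)).re

lemma measurable_circleCoord : Measurable circleCoord := by
  have h : Measurable fun ζ : Circle => (ζ : ℂ) := continuous_coe_circle.measurable
  exact Complex.measurable_re.comp
    (((measurable_const.add h).const_mul I).div (measurable_const.sub h))

lemma cayleyCircle_circleCoord {ζ : Circle} (h : ζ ≠ 1) : cayleyCircle (circleCoord ζ) = ζ := by
  have h1 : (1 : ℂ) - ζ ≠ 0 := by
    rw [sub_ne_zero]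
    exact fun h' => h (Circle.ext (by simpa using h'.symm))
  have hζ : (ζ : ℂ) * conj (ζ : ℂ) = 1 := by
    rw [mul_conj, Circle.normSq_coe, ofReal_one]
  have h1' : conj ((1 : ℂ) - ζ) ≠ 0 := (map_ne_zero _).2 h1
  have hx : (circleCoord ζ : ℂ) = I * (1 + ζ) / (1 - ζ) := by
    refine conj_eq_iff_re.1 ?_
    rw [map_div₀, div_eq_div_iff h1' h1]
    simp only [map_mul, map_add, map_sub, map_one, conj_I]
    linear_combination (2 * I) * hζ
  refine Circle.ext ?_
  have h2 := ofReal_add_I_ne_zero (circleCoord ζ)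
  rw [coe_cayleyCircle, div_eq_iff h2]
  refine mul_right_cancel₀ h1 ?_
  have h3 : (circleCoord ζ : ℂ) * (1 - ζ) = I * (1 + ζ) := by rw [hx, div_mul_cancel₀ _ h1]
  linear_combination (1 - ζ : ℂ) * h3

/-- The point 1 is the Cayley image of infinity; an atom there produces the linear term of the
Nevanlinna representation. -/
lemma pickKernel_one {z : ℂ} : pickKernel ((1 : Circle) : ℂ) z = z := by
  have h : pickDenom ((1 : Circle) : ℂ) z = 2 * I := by
    rw [pickDenom, Circle.coe_one]
    ring
  rw [pickKernel, h, Circle.coe_one, div_eq_iff (mul_ne_zero two_ne_zero I_ne_zero)]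
  ring

/-- The Nevanlinna representation on the real line. -/
lemma IsPick.exists_lkKernel {g : ℂ → ℂ} (hg : IsPick g) :
    ∃ (γ b : ℝ) (τ : Measure ℝ), 0 ≤ b ∧ IsFiniteMeasure τ ∧ ∀ z ∈ offReal,
      g z = -(γ : ℂ) + b * z + ∫ x, lkKernel x z ∂τ := by
  obtain ⟨γ, ν, h⟩ := hg
  -- The atom at 1 becomes the coefficient b; the rest of ν is carried to the line.
  refine ⟨-γ, (ν : Measure Circle).real {1},
    ((ν : Measure Circle).restrict {1}ᶜ).map circleCoord, measureReal_nonneg, inferInstance,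
    fun z hz => ?_⟩
  have hae : AEStronglyMeasurable (fun x => lkKernel x z)
      (((ν : Measure Circle).restrict {1}ᶜ).map circleCoord) :=
    (integrable_lkKernel hz _).aestronglyMeasurable
  rw [h z hz, integral_map measurable_circleCoord.aemeasurable hae,
    ← integral_add_compl (measurableSet_singleton (1 : Circle))
      (integrable_pickKernel hz (ν : Measure Circle))]
  rw [integral_singleton, pickKernel_one]
  have : ∫ ζ in ({1} : Set Circle)ᶜ, pickKernel ζ z ∂(ν : Measure Circle) =
      ∫ ζ in ({1} : Set Circle)ᶜ, lkKernel (circleCoord ζ) z ∂(ν : Measure Circle) := by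
    refine setIntegral_congr_fun (measurableSet_singleton (1 : Circle)).compl fun ζ hζ => ?_
    rw [← pickKernel_cayleyCircle _ hz, cayleyCircle_circleCoord hζ]
  rw [this, real_smul]
  push_cast
  ring

/-! ### Herglotz representation of holomorphic functions -/

section Herglotz

open Real (circleAverage)

/-- Write i Im p = (p - conj p)/2. Against the Herglotz kernel the p-part is given by Cauchy's
formula. On the circle the kernel is also the conjugate of a function holomorphic in ζ, so the conj
p part follows from the mean value property. -/
lemma herglotz_formula {p : ℂ → ℂ} (hp : DiffContOnCl ℂ p (Metric.ball 0 1)) {w : ℂ}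
    (hw : w ∈ Metric.ball (0 : ℂ) 1) :
    p w = (p 0).re +
      circleAverage (fun ζ => I * ((ζ + w) / (ζ - w)) * ((p ζ).im : ℂ)) 0 1 := by
  have hw1 : ‖w‖ < 1 := by simpa using hw
  have hpc : ContinuousOn p (Metric.sphere 0 1) := by
    refine hp.continuousOn.mono ?_
    rw [closure_ball _ one_ne_zero]
    exact Metric.sphere_subset_closedBall
  have hne : ∀ ζ ∈ Metric.sphere (0 : ℂ) 1, ζ - w ≠ 0 := fun ζ hζ h => by
    rw [sub_eq_zero.1 h] at hζ
    simp at hζ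
    linarith
  have hne' : ∀ ζ : ℂ, ‖ζ‖ ≤ 1 → 1 - conj w * ζ ≠ 0 := fun ζ hζ h => by
    have h1 : ‖conj w * ζ‖ = 1 := by rw [← sub_eq_zero.1 h, norm_one]
    rw [norm_mul, norm_conj] at h1
    nlinarith [norm_nonneg w, norm_nonneg ζ]
  have e1 : circleAverage (fun ζ => (ζ / (ζ - w)) * p ζ) 0 1 = p w := by
    have := DiffContOnCl.circleAverage_smul_div (f := p) (c := 0) (R := 1) (w := w)
      (by simpa using hp) (by simpa using hw)
    simpa using this
  have e2 : circleAverage p 0 1 = p 0 :=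
    DiffContOnCl.circleAverage (E := ℂ) (f := p) (c := 0) (R := 1) (by simpa using hp)
  have e3 : circleAverage (fun ζ => ((1 + conj w * ζ) / (1 - conj w * ζ)) * p ζ) 0 1 = p 0 := by
    have hq : DiffContOnCl ℂ (fun ζ => ((1 + conj w * ζ) / (1 - conj w * ζ)) * p ζ)
        (Metric.ball 0 |1|) := by
      rw [abs_one]
      refine DiffContOnCl.smul (c := fun ζ => (1 + conj w * ζ) / (1 - conj w * ζ))
        (DifferentiableOn.diffContOnCl ?_) hp
      rw [closure_ball _ one_ne_zero]
      refine DifferentiableOn.div (by fun_prop) (by fun_prop) fun ζ hζ => hne' ζ (by simpa using hζ)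
    have := hq.circleAverage
    simpa using this
  have i1 : CircleIntegrable (fun ζ => (ζ / (ζ - w)) * p ζ) 0 1 := by
    refine ContinuousOn.circleIntegrable zero_le_one ((ContinuousOn.div (by fun_prop)
      (by fun_prop) hne).mul hpc)
  have i2 : CircleIntegrable p 0 1 := hpc.circleIntegrable zero_le_one
  have i3 : CircleIntegrable (fun ζ => ((1 + conj w * ζ) / (1 - conj w * ζ)) * p ζ) 0 1 := by
    refine ContinuousOn.circleIntegrable zero_le_one ((ContinuousOn.div (by fun_prop)
      (by fun_prop) fun ζ hζ => hne' ζ (by simp at hζ; exact hζ.le)).mul hpc)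
  have i4 : CircleIntegrable
      (fun ζ => conj (((1 + conj w * ζ) / (1 - conj w * ζ)) * p ζ)) 0 1 := by
    refine ContinuousOn.circleIntegrable zero_le_one (Complex.continuous_conj.comp_continuousOn
      ((ContinuousOn.div (by fun_prop)
      (by fun_prop) fun ζ hζ => hne' ζ (by simp at hζ; exact hζ.le)).mul hpc))
  have e4 : circleAverage (fun ζ => conj (((1 + conj w * ζ) / (1 - conj w * ζ)) * p ζ)) 0 1 =
      conj (p 0) := by
    have := ContinuousLinearMap.circleAverage_comp_comm (conjCLE : ℂ →L[ℝ] ℂ) i3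
    rw [e3] at this
    exact this
  have key : circleAverage (fun ζ => I * ((ζ + w) / (ζ - w)) * ((p ζ).im : ℂ)) 0 1 =
      circleAverage (fun ζ => ((ζ / (ζ - w)) * p ζ - (1 / 2 : ℂ) • p ζ) -
        (1 / 2 : ℂ) • conj (((1 + conj w * ζ) / (1 - conj w * ζ)) * p ζ)) 0 1 := by
    refine Real.circleAverage_congr_sphere fun ζ hζ => ?_
    rw [abs_one] at hζ
    have hζ1 : ζ * conj ζ = 1 := by
      rw [mul_conj, normSq_eq_norm_sq]
      simp at hζ
      simp [hζ]
    have h1 := hne ζ hζ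
    have h3 : conj ((1 : ℂ) - conj w * ζ) ≠ 0 :=
      (map_ne_zero _).2 (hne' ζ (by simp at hζ; exact hζ.le))
    -- Uses conj ζ = 1/ζ on the circle.
    have h2 : conj ((1 + conj w * ζ) / (1 - conj w * ζ)) = (ζ + w) / (ζ - w) := by
      rw [map_div₀, div_eq_div_iff h3 h1]
      simp only [map_add, map_mul, map_sub, map_one, conj_conj]
      linear_combination (2 * w) * hζ1
    have him : ((p ζ).im : ℂ) * I = (p ζ - conj (p ζ)) / 2 := by
      rw [sub_conj]
      push_cast
      ring
    have h4 : ζ / (ζ - w) = ((ζ + w) / (ζ - w) + 1) / 2 := by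
      field_simp
      ring
    rw [map_mul, h2, h4]
    simp only [smul_eq_mul]
    linear_combination ((ζ + w) / (ζ - w)) * him
  have i2' : CircleIntegrable (fun ζ => (1 / 2 : ℂ) • p ζ) 0 1 :=
    ContinuousOn.circleIntegrable zero_le_one (by fun_prop)
  have i4' : CircleIntegrable
      (fun ζ => (1 / 2 : ℂ) • conj (((1 + conj w * ζ) / (1 - conj w * ζ)) * p ζ)) 0 1 := by
    refine ContinuousOn.circleIntegrable zero_le_one (ContinuousOn.fun_const_smul
      (Complex.continuous_conj.comp_continuousOn ((ContinuousOn.div (by fun_prop)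
      (by fun_prop) fun ζ hζ => hne' ζ (by simp at hζ; exact hζ.le)).mul hpc)) _)
  have i5 : CircleIntegrable (fun ζ => (ζ / (ζ - w)) * p ζ - (1 / 2 : ℂ) • p ζ) 0 1 :=
    i1.sub i2'
  rw [key, Real.circleAverage_fun_sub i5 i4', Real.circleAverage_fun_sub i1 i2',
    Real.circleAverage_fun_smul, Real.circleAverage_fun_smul, e1, e2, e4]
  have : ((p 0).re : ℂ) = (p 0 + conj (p 0)) / 2 := by
    rw [add_conj]
    push_cast
    ring
  rw [this]
  simp only [smul_eq_mul]
  ring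

/-- The Cayley transform from the upper half-plane to the unit disc. -/
def toDisc (z : ℂ) : ℂ := (z - I) / (z + I)

/-- The inverse Cayley transform. -/
def ofDisc (w : ℂ) : ℂ := I * (1 + w) / (1 - w)

lemma add_I_ne_zero {z : ℂ} (hz : 0 < z.im) : z + I ≠ 0 := by
  intro h
  have := congrArg Complex.im h
  simp at this
  linarith

lemma norm_toDisc_lt {z : ℂ} (hz : 0 < z.im) : ‖toDisc z‖ < 1 := by
  rw [toDisc, norm_div, div_lt_one (norm_pos_iff.2 (add_I_ne_zero hz))]
  have := norm_add_I_sq_sub z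
  exact lt_of_pow_lt_pow_left₀ 2 (norm_nonneg _) (by linarith)

lemma one_sub_ne_zero_of_norm_lt {w : ℂ} (hw : ‖w‖ < 1) : 1 - w ≠ 0 := by
  rw [sub_ne_zero]
  rintro rfl
  simp at hw

lemma ofDisc_im_pos {w : ℂ} (hw : ‖w‖ < 1) : 0 < (ofDisc w).im := by
  have h1 := one_sub_ne_zero_of_norm_lt hw
  have h2 : 0 < normSq (1 - w) := normSq_pos.2 h1
  have h3 : normSq w < 1 := by
    rw [normSq_eq_norm_sq]
    nlinarith [norm_nonneg w]
  have : (ofDisc w).im = (1 - normSq w) / normSq (1 - w) := by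
    rw [ofDisc, div_im]
    field_simp
    simp [normSq_apply]
    ring
  rw [this]
  exact div_pos (by linarith) h2

lemma ofDisc_toDisc {z : ℂ} (hz : 0 < z.im) : ofDisc (toDisc z) = z := by
  have h1 := add_I_ne_zero hz
  have h2 := one_sub_ne_zero_of_norm_lt (norm_toDisc_lt hz)
  have h3 : toDisc z * (z + I) = z - I := div_mul_cancel₀ _ h1
  rw [ofDisc, div_eq_iff h2]
  refine mul_right_cancel₀ h1 ?_
  linear_combination (I + z) * h3

lemma pickKernel_eq_toDisc (ζ : Circle) {z : ℂ} (hz : 0 < z.im) :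
    pickKernel ζ z = I * (((ζ : ℂ) + toDisc z) / (ζ - toDisc z)) := by
  have h1 := add_I_ne_zero hz
  have h2 := pickDenom_ne_zero ζ (mem_offReal_of_pos hz)
  have h3 : toDisc z * (z + I) = z - I := div_mul_cancel₀ _ h1
  have h4 : (ζ : ℂ) - toDisc z ≠ 0 := by
    rw [sub_ne_zero]
    intro h
    have := norm_toDisc_lt hz
    rw [← h, Circle.norm_coe] at this
    exact lt_irrefl _ this
  rw [pickKernel, ← mul_div_assoc, div_eq_div_iff h2 h4]
  simp only [pickDenom]
  linear_combination (-2 * I * ζ) * h3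

/-- The representing measure is Im p times normalised arc length. -/
lemma exists_finiteMeasure_of_disc {p : ℂ → ℂ} (hp : DiffContOnCl ℂ p (Metric.ball 0 1))
    (him : ∀ ζ : Circle, 0 ≤ (p ζ).im) :
    ∃ ν : FiniteMeasure Circle, ∀ z : ℂ, 0 < z.im →
      p (toDisc z) = (p 0).re + ∫ ζ : Circle, pickKernel ζ z ∂(ν : Measure Circle) := by
  have hpc : Continuous fun ζ : Circle => (p ζ).im := by
    refine Complex.continuous_im.comp
      (hp.continuousOn.comp_continuous continuous_coe_circle fun ζ => ?_)
    rw [closure_ball _ one_ne_zero, mem_closedBall_zero_iff, Circle.norm_coe]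
  let d : ℝ → ℝ≥0 := fun θ => ((2 * Real.pi)⁻¹ * (p (Circle.exp θ)).im).toNNReal
  have hd : Continuous d :=
    continuous_real_toNNReal.comp ((hpc.comp Circle.exp.continuous).const_mul _)
  let m : Measure ℝ := (volume.restrict (Ioc 0 (2 * Real.pi))).withDensity fun θ => d θ
  have hm : IsFiniteMeasure m := by
    refine isFiniteMeasure_withDensity ?_
    have : IntegrableOn (fun θ => (d θ : ℝ)) (Ioc 0 (2 * Real.pi)) :=
      (NNReal.continuous_coe.comp hd).integrableOn_Ioc
    have h := this.lintegral_lt_top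
    simpa using h.ne
  refine ⟨⟨m.map Circle.exp, inferInstance⟩, fun z hz => ?_⟩
  rw [herglotz_formula hp (w := toDisc z) (by simpa using norm_toDisc_lt hz)]
  congr 1
  rw [FiniteMeasure.toMeasure_mk, integral_map Circle.exp.continuous.aemeasurable
    (continuous_pickKernel (mem_offReal_of_pos hz)).aestronglyMeasurable,
    integral_withDensity_eq_integral_smul hd.measurable, Real.circleAverage_def,
    intervalIntegral.integral_of_le Real.two_pi_pos.le, ← integral_smul]
  congr 1
  ext θ
  have hθ : circleMap 0 1 θ = (Circle.exp θ : ℂ) := by simp [circleMap]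
  have h0 : 0 ≤ (2 * Real.pi)⁻¹ * (p (Circle.exp θ)).im :=
    mul_nonneg (by positivity) (him _)
  rw [hθ, pickKernel_eq_toDisc _ hz, NNReal.smul_def, Real.coe_toNNReal _ h0, real_smul, real_smul]
  push_cast
  ring

/-- Holomorphic self-maps of the closed upper half-plane, extended by symmetry, are Pick
functions. -/
theorem isPick_of_differentiableOn {f : ℂ → ℂ} (hf : DifferentiableOn ℂ f {z | 0 < z.im})
    (him : ∀ z : ℂ, 0 < z.im → 0 ≤ (f z).im)
    (hconj : ∀ z : ℂ, 0 < z.im → f (conj z) = conj (f z)) : IsPick f := by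
  have hr0 : ∀ n : ℕ, 0 < (1 - 1 / ((n : ℝ) + 2)) := fun n => by
    rw [sub_pos, div_lt_one (by positivity)]
    linarith [(n.cast_nonneg : (0 : ℝ) ≤ n)]
  have hr1 : ∀ n : ℕ, (1 - 1 / ((n : ℝ) + 2)) < 1 := fun n => by
    have : 0 < 1 / ((n : ℝ) + 2) := by positivity
    linarith
  -- Radii in (0, 1) tending to 1; the shift by 2 keeps the radius positive at n = 0.
  set r : ℕ → ℝ := fun n => 1 - 1 / ((n : ℝ) + 2) with hr
  have hrlim : Tendsto r atTop (𝓝 1) := by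
    have : Tendsto (fun n : ℕ => 1 / ((n : ℝ) + 2)) atTop (𝓝 0) :=
      tendsto_const_nhds.div_atTop (tendsto_atTop_add_const_right _ _ tendsto_natCast_atTop_atTop)
    simpa [hr] using this.const_sub 1
  have hn : ∀ n (w : ℂ), ‖w‖ ≤ 1 → ‖(r n : ℂ) * w‖ < 1 := fun n w hw => by
    rw [norm_mul, norm_real, Real.norm_of_nonneg (hr0 n).le]
    nlinarith [hr0 n, hr1 n, norm_nonneg w]
  -- After dilation the function is holomorphic across the unit circle, so the disc formula applies;
  -- the limit n → ∞ stays Pick by compactness.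
  have hp : ∀ n, DiffContOnCl ℂ (fun w => f (ofDisc (r n * w))) (Metric.ball 0 1) := fun n => by
    refine DifferentiableOn.diffContOnCl ?_
    rw [closure_ball _ one_ne_zero]
    refine hf.comp (t := {z | 0 < z.im}) (f := fun w => ofDisc (r n * w)) ?_ ?_
    · refine DifferentiableOn.div (by fun_prop) (by fun_prop) fun w hw =>
        one_sub_ne_zero_of_norm_lt (hn n w (by simpa using hw))
    · exact fun w hw => ofDisc_im_pos (hn n w (by simpa using hw))
  choose ν hν using fun n => exists_finiteMeasure_of_disc (hp n) fun ζ =>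
    him _ (ofDisc_im_pos (hn n _ (Circle.norm_coe ζ).le))
  have hup : ∀ z : ℂ, 0 < z.im → Tendsto (fun n => ((f (ofDisc (r n * 0))).re : ℂ) +
      ∫ ζ : Circle, pickKernel ζ z ∂(ν n : Measure Circle)) atTop (𝓝 (f z)) := fun z hz => by
    have h1 : ContinuousAt f z :=
      (hf.differentiableAt ((isOpen_lt continuous_const Complex.continuous_im).mem_nhds
        hz)).continuousAt
    have h2 : Tendsto (fun n => (r n : ℂ) * toDisc z) atTop (𝓝 (toDisc z)) := by
      simpa using ((Complex.continuous_ofReal.tendsto _).comp hrlim).mul_const (toDisc z)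
    have h3 : ContinuousAt ofDisc (toDisc z) := by
      unfold ofDisc
      exact ContinuousAt.div (by fun_prop) (by fun_prop)
        (one_sub_ne_zero_of_norm_lt (norm_toDisc_lt hz))
    have h4 := h3.tendsto.comp h2
    rw [ofDisc_toDisc hz] at h4
    exact (h1.tendsto.comp h4).congr fun n => hν n z hz
  refine IsPick.of_tendsto (l := (atTop : Filter ℕ)) (g := fun n z =>
    ((f (ofDisc (r n * 0))).re : ℂ) + ∫ ζ : Circle, pickKernel ζ z ∂(ν n : Measure Circle))
    (Eventually.of_forall fun n => ⟨_, ν n, fun z _ => rfl⟩) fun z hz => ?_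
  rcases lt_or_gt_of_ne hz with h | h
  · have hz' : 0 < (conj z).im := by simpa using h
    have h1 := (Complex.continuous_conj.tendsto _).comp (hup _ hz')
    rw [← hconj _ hz', conj_conj] at h1
    refine h1.congr fun n => ?_
    rw [Function.comp_apply, map_add, conj_ofReal, ← integral_conj]
    simp only [conj_pickKernel _ (conj_mem_offReal hz), conj_conj]
  · exact hup z h

end Herglotz

/-! ### Characterisation of reciprocal Cauchy transforms -/

lemma lkKernel_add (x : ℝ) {z : ℂ} (hz : z ∈ offReal) :
    lkKernel x z + x = (1 + (x : ℂ) ^ 2) * (1 / ((x : ℂ) - z)) := by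
  have := ofReal_sub_ne_zero x hz
  rw [lkKernel]
  field_simp
  ring

lemma one_add_sq_ne_zero (x : ℝ) : (1 + (x : ℂ) ^ 2) ≠ 0 := by
  have : (1 + x ^ 2 : ℝ) ≠ 0 := by positivity
  exact_mod_cast this

lemma continuous_resolvent {z : ℂ} (hz : z ∈ offReal) :
    Continuous fun x : ℝ => 1 / ((x : ℂ) - z) :=
  Continuous.div (by fun_prop) (by fun_prop) fun x => ofReal_sub_ne_zero x hz

lemma norm_resolvent_le {z : ℂ} (hz : z ∈ offReal) (x : ℝ) :
    ‖1 / ((x : ℂ) - z)‖ ≤ 1 / |z.im| := by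
  rw [norm_div, norm_one]
  have h : 0 < |z.im| := abs_pos.2 hz
  have := abs_im_le_norm ((x : ℂ) - z)
  rw [sub_im, ofReal_im, zero_sub, abs_neg] at this
  gcongr

lemma integrable_resolvent {z : ℂ} (hz : z ∈ offReal) (μ : Measure ℝ) [IsFiniteMeasure μ] :
    Integrable (fun x : ℝ => 1 / ((x : ℂ) - z)) μ :=
  Integrable.of_bound (continuous_resolvent hz).aestronglyMeasurable _
    (Eventually.of_forall (norm_resolvent_le hz))

lemma cauchyTransform_eq_neg (μ : Measure ℝ) (z : ℂ) :
    cauchyTransform μ z = -∫ x : ℝ, 1 / ((x : ℂ) - z) ∂μ := by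
  rw [cauchyTransform, ← integral_neg]
  congr 1
  ext x
  rw [← neg_sub (x : ℂ) z, div_neg]

lemma resolvent_im (x : ℝ) (z : ℂ) :
    (1 / ((x : ℂ) - z)).im = z.im * ‖1 / ((x : ℂ) - z)‖ ^ 2 := by
  rw [one_div, inv_im, norm_inv, inv_pow, ← normSq_eq_norm_sq, sub_im, ofReal_im, zero_sub,
    neg_neg, div_eq_mul_inv]

lemma isPick_neg_cauchyTransform (μ : Measure ℝ) [IsFiniteMeasure μ] :
    IsPick fun z => -cauchyTransform μ z := by
  let d : ℝ → ℝ≥0 := fun x => (1 / (1 + x ^ 2)).toNNReal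
  have hd : Continuous d :=
    continuous_real_toNNReal.comp (Continuous.div (by fun_prop) (by fun_prop)
      fun x => by positivity)
  have hdx : ∀ x, (d x : ℝ) = 1 / (1 + x ^ 2) := fun x => Real.coe_toNNReal _ (by positivity)
  have hfin : IsFiniteMeasure (μ.withDensity fun x => d x) := by
    refine isFiniteMeasure_withDensity (ne_of_lt ?_)
    calc ∫⁻ x, (d x : ENNReal) ∂μ ≤ ∫⁻ _, 1 ∂μ := by
          refine lintegral_mono fun x => ?_
          have : d x ≤ 1 := by
            rw [← NNReal.coe_le_coe, hdx, NNReal.coe_one, div_le_one (by positivity)]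
            nlinarith
          exact ENNReal.coe_le_one_iff.2 this
      _ < ⊤ := by simp [measure_lt_top]
  have hint : Integrable (fun x : ℝ => x / (1 + x ^ 2)) μ := by
    refine Integrable.of_bound (C := 1) (Continuous.aestronglyMeasurable
      (Continuous.div (by fun_prop) (by fun_prop) fun x => by positivity))
      (Eventually.of_forall fun x => ?_)
    rw [Real.norm_eq_abs, abs_div, abs_of_pos (show 0 < 1 + x ^ 2 by positivity),
      div_le_one (by positivity)]
    nlinarith [sq_nonneg (|x| - 1), sq_abs x]
  -- Dividing `lkKernel_add` by 1 + x² writes the resolvent as a multiple of the kernel plus the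
  -- real term x/(1 + x²).
  refine isPick_of_integral_lkKernel (∫ x, x / (1 + x ^ 2) ∂μ) (μ.withDensity fun x => d x)
    fun z hz => ?_
  rw [integral_withDensity_eq_integral_smul hd.measurable, cauchyTransform_eq_neg, neg_neg,
    ← integral_complex_ofReal, ← integral_add hint.ofReal]
  · congr 1
    ext x
    have h1 := one_add_sq_ne_zero x
    have h2 := ofReal_sub_ne_zero x hz
    rw [NNReal.smul_def, hdx, real_smul, eq_sub_of_add_eq (lkKernel_add x hz)]
    push_cast
    field_simp
    ring
  · have hint' : Integrable (fun x : ℝ => ((x / (1 + x ^ 2) : ℝ) : ℂ)) μ := hint.ofReal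
    refine ((integrable_resolvent hz μ).sub hint').congr
      (Eventually.of_forall fun x => ?_)
    have h1 := one_add_sq_ne_zero x
    have h2 := ofReal_sub_ne_zero x hz
    beta_reduce
    rw [NNReal.smul_def, hdx, real_smul, eq_sub_of_add_eq (lkKernel_add x hz), Pi.sub_apply]
    push_cast
    field_simp

/-- Since -Im G(z) = Im z ∫ |x - z|⁻² dμ, this is Jensen's inequality. Dividing by |G|² gives
Im(1/G) ≥ Im z. -/
lemma mul_sq_norm_cauchyTransform_le (μ : Measure ℝ) [IsProbabilityMeasure μ] {z : ℂ}
    (hz : 0 < z.im) :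
    z.im * ‖cauchyTransform μ z‖ ^ 2 ≤ -(cauchyTransform μ z).im ∧
      0 < -(cauchyTransform μ z).im := by
  have hz' := mem_offReal_of_pos hz
  have hi := integrable_resolvent hz' μ
  set h : ℝ → ℂ := fun x => 1 / ((x : ℂ) - z) with hh
  have hsq : Integrable (fun x => ‖h x‖ ^ 2) μ := by
    refine Integrable.of_bound (C := (1 / |z.im|) ^ 2)
      ((continuous_resolvent hz').norm.pow 2).aestronglyMeasurable
      (Eventually.of_forall fun x => ?_)
    rw [norm_pow, norm_norm]
    exact pow_le_pow_left₀ (norm_nonneg _) (norm_resolvent_le hz' x) 2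
  have him : -(cauchyTransform μ z).im = z.im * ∫ x, ‖h x‖ ^ 2 ∂μ := by
    rw [cauchyTransform_eq_neg, neg_im, neg_neg, ← integral_const_mul]
    have := integral_im (𝕜 := ℂ) hi
    simp only [RCLike.im_to_complex] at this
    rw [← this]
    simp only [hh, resolvent_im]
  have hjensen : (∫ x, ‖h x‖ ∂μ) ^ 2 ≤ ∫ x, ‖h x‖ ^ 2 ∂μ := by
    set m := ∫ x, ‖h x‖ ∂μ
    -- The variance of the norm of the resolvent.
    have h0 : 0 ≤ ∫ x, (‖h x‖ ^ 2 - 2 * m * ‖h x‖ + m ^ 2) ∂μ :=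
      integral_nonneg fun x => by
        have : ‖h x‖ ^ 2 - 2 * m * ‖h x‖ + m ^ 2 = (‖h x‖ - m) ^ 2 := by ring
        simp only [Pi.zero_apply, this]
        positivity
    have hs : Integrable (fun x => ‖h x‖ ^ 2 - 2 * m * ‖h x‖) μ :=
      hsq.sub (hi.norm.const_mul _)
    rw [integral_add hs (integrable_const _),
      integral_sub hsq (hi.norm.const_mul _), integral_const_mul] at h0
    simp at h0
    nlinarith
  have hpos : 0 < ∫ x, ‖h x‖ ^ 2 ∂μ := by
    rw [integral_pos_iff_support_of_nonneg (fun x => by positivity) hsq]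
    have : Function.support (fun x => ‖h x‖ ^ 2) = univ := by
      ext x
      simpa [hh] using ofReal_sub_ne_zero x hz'
    rw [this]
    simp
  have hle : ‖cauchyTransform μ z‖ ≤ ∫ x, ‖h x‖ ∂μ := by
    rw [cauchyTransform_eq_neg, norm_neg]
    exact norm_integral_le_integral_norm _
  rw [him]
  refine ⟨?_, mul_pos hz hpos⟩
  have := pow_le_pow_left₀ (norm_nonneg _) hle 2
  nlinarith

lemma cauchyTransform_ne_zero (μ : Measure ℝ) [IsProbabilityMeasure μ] {z : ℂ}
    (hz : 0 < z.im) : cauchyTransform μ z ≠ 0 := fun h => by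
  have := (mul_sq_norm_cauchyTransform_le μ hz).2
  rw [h] at this
  simp at this

lemma im_le_im_reciprocalCauchyTransform (μ : Measure ℝ) [IsProbabilityMeasure μ] {z : ℂ}
    (hz : 0 < z.im) : z.im ≤ (reciprocalCauchyTransform μ z).im := by
  have h1 := (mul_sq_norm_cauchyTransform_le μ hz).1
  have h2 : 0 < ‖cauchyTransform μ z‖ ^ 2 :=
    pow_pos (norm_pos_iff.2 (cauchyTransform_ne_zero μ hz)) 2
  rw [reciprocalCauchyTransform, one_div, inv_im, normSq_eq_norm_sq, le_div_iff₀ h2]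
  exact h1

lemma IsReciprocalCauchyTransform.im_le {K : ℂ → ℂ} (hK : IsReciprocalCauchyTransform K) {z : ℂ}
    (hz : 0 < z.im) : z.im ≤ (K z).im := by
  obtain ⟨μ, hμ, h⟩ := hK
  rw [h z (mem_offReal_of_pos hz)]
  exact im_le_im_reciprocalCauchyTransform μ hz

lemma isOpen_upper : IsOpen {z : ℂ | 0 < z.im} :=
  isOpen_lt continuous_const Complex.continuous_im

lemma upper_subset_offReal : {z : ℂ | 0 < z.im} ⊆ offReal := fun _ hz => mem_offReal_of_pos hz

/-- Subtracting the identity from a reciprocal Cauchy transform gives a Pick function. -/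
theorem IsReciprocalCauchyTransform.isPick {K : ℂ → ℂ} (hK : IsReciprocalCauchyTransform K) :
    IsPick fun z => K z - z := by
  have hK' := hK
  obtain ⟨μ, hμ, h⟩ := hK
  have hG := isPick_neg_cauchyTransform μ
  refine isPick_of_differentiableOn ?_ (fun z hz => ?_) fun z hz => ?_
  · have h1 : DifferentiableOn ℂ (cauchyTransform μ) {z | 0 < z.im} := by
      simpa using (hG.differentiableOn.mono upper_subset_offReal).fun_neg
    refine DifferentiableOn.sub (DifferentiableOn.congr (f := fun z => 1 / cauchyTransform μ z) ?_
      fun z hz => h z (mem_offReal_of_pos hz)) differentiableOn_id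
    exact DifferentiableOn.div (differentiableOn_const _) h1 fun z hz =>
      cauchyTransform_ne_zero μ hz
  · rw [sub_im]
    linarith [hK'.im_le hz]
  · have h1 := hG.conj_apply (mem_offReal_of_pos hz)
    rw [map_neg, neg_inj] at h1
    rw [h _ (conj_mem_offReal (mem_offReal_of_pos hz)), h z (mem_offReal_of_pos hz),
      reciprocalCauchyTransform, reciprocalCauchyTransform, h1]
    simp

/-- The integrand iy/(iy - x) is bounded by 1 and tends to 1; dominated convergence leaves the mass
of μ. -/
lemma tendsto_mul_cauchyTransform (μ : Measure ℝ) [IsProbabilityMeasure μ] :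
    Tendsto (fun y : ℝ => (y * I) * cauchyTransform μ (y * I)) atTop (𝓝 1) := by
  have h1 : ∀ y : ℝ, (y * I) * cauchyTransform μ (y * I) =
      ∫ x : ℝ, (y * I) / (y * I - x) ∂μ := fun y => by
    rw [cauchyTransform, ← integral_const_mul]
    simp only [mul_one_div]
  simp only [h1]
  have h2 : (1 : ℂ) = ∫ _ : ℝ, (1 : ℂ) ∂μ := by simp
  rw [h2]
  refine tendsto_integral_filter_of_dominated_convergence (fun _ => 1) ?_ ?_ (integrable_const _)
    (Eventually.of_forall fun x => ?_)
  · filter_upwards with y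
    exact (Measurable.div (by fun_prop) (by fun_prop)).aestronglyMeasurable
  · filter_upwards [eventually_gt_atTop 0] with y hy
    refine Eventually.of_forall fun x => ?_
    rw [norm_div]
    refine div_le_one_of_le₀ ?_ (norm_nonneg _)
    have := abs_im_le_norm ((y : ℂ) * I - x)
    simpa using this
  · have h3 : Tendsto (fun y : ℝ => 1 - (x : ℂ) * I⁻¹ * ((y⁻¹ : ℝ) : ℂ)) atTop (𝓝 1) := by
      have := ((Complex.continuous_ofReal.tendsto _).comp tendsto_inv_atTop_zero).const_mul
        ((x : ℂ) * I⁻¹)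
      simpa using this.const_sub 1
    have h4 := h3.inv₀ one_ne_zero
    rw [inv_one] at h4
    refine h4.congr' ?_
    filter_upwards [eventually_gt_atTop 0] with y hy
    have hy' : (y : ℂ) * I ≠ 0 := mul_ne_zero (by exact_mod_cast hy.ne') I_ne_zero
    rw [inv_eq_iff_eq_inv, inv_div, sub_div, div_self hy', ofReal_inv, div_eq_mul_inv, mul_inv]
    ring

lemma IsReciprocalCauchyTransform.tendsto {K : ℂ → ℂ} (hK : IsReciprocalCauchyTransform K) :
    Tendsto (fun y : ℝ => K (y * I) / (y * I)) atTop (𝓝 1) := by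
  obtain ⟨μ, hμ, h⟩ := hK
  have h1 := (tendsto_mul_cauchyTransform μ).inv₀ one_ne_zero
  rw [inv_one] at h1
  refine h1.congr' ?_
  filter_upwards [eventually_gt_atTop 0] with y hy
  rw [h _ (mem_offReal_of_pos (by simpa using hy)), reciprocalCauchyTransform, mul_inv]
  ring

lemma lkKernel_im (x : ℝ) {z : ℂ} (hz : z ∈ offReal) :
    (lkKernel x z).im = (1 + x ^ 2) * (z.im * ‖1 / ((x : ℂ) - z)‖ ^ 2) := by
  rw [eq_sub_of_add_eq (lkKernel_add x hz), sub_im, ofReal_im, sub_zero, ← resolvent_im]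
  rw [show (1 + (x : ℂ) ^ 2) = ((1 + x ^ 2 : ℝ) : ℂ) by push_cast; ring,
    im_ofReal_mul]

/-- A characterisation of reciprocal Cauchy transforms by their boundary behaviour at infinity. -/
theorem isReciprocalCauchyTransform_of {K : ℂ → ℂ}
    (hd : DifferentiableOn ℂ K {z | 0 < z.im})
    (him : ∀ z : ℂ, 0 < z.im → z.im ≤ (K z).im)
    (hconj : ∀ z : ℂ, 0 < z.im → K (conj z) = conj (K z))
    (hlim : Tendsto (fun y : ℝ => K (y * I) / (y * I)) atTop (𝓝 1)) :
    IsReciprocalCauchyTransform K := by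
  have hK0 : ∀ z : ℂ, 0 < z.im → K z ≠ 0 := fun z hz h => by
    have := him z hz
    rw [h, zero_im] at this
    linarith
  have hN : IsPick fun z => -(K z)⁻¹ := by
    refine isPick_of_differentiableOn (hd.inv hK0).neg (fun z hz => ?_) fun z hz => ?_
    · rw [neg_im, inv_im, neg_div, neg_neg]
      exact div_nonneg (hz.le.trans (him z hz)) (normSq_nonneg _)
    · rw [hconj z hz, map_neg, map_inv₀]
  obtain ⟨γ, b, τ, hb, hτ, hrep⟩ := hN.exists_lkKernel
  have hoff : ∀ {y : ℝ}, 0 < y → (y : ℂ) * I ∈ offReal := fun hy =>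
    mem_offReal_of_pos (by simpa using hy)
  have hlim1 : Tendsto (fun y : ℝ => (y * I) * -(K (y * I))⁻¹) atTop (𝓝 (-1)) := by
    have h1 := (hlim.inv₀ one_ne_zero).neg
    rw [inv_one] at h1
    refine h1.congr fun y => ?_
    rw [inv_div]
    ring
  -- Here `q y x` is y times the imaginary part of the kernel at iy. It increases to 1 + x² as y →
  -- ∞.
  let q : ℝ → ℝ → ℝ := fun y x => (1 + x ^ 2) * (y ^ 2 / (x ^ 2 + y ^ 2))
  have hnorm : ∀ x y : ℝ, ‖1 / ((x : ℂ) - y * I)‖ ^ 2 = 1 / (x ^ 2 + y ^ 2) := fun x y => by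
    rw [norm_div, norm_one, div_pow, one_pow, ← normSq_eq_norm_sq]
    simp [normSq_apply, sq]
  have hq : ∀ {y : ℝ}, 0 < y → ∀ x, y * (lkKernel x (y * I)).im = q y x := fun hy x => by
    rw [lkKernel_im x (hoff hy), hnorm]
    simp [q]
    ring
  have hq0 : ∀ y x, 0 ≤ q y x := fun y x => by positivity
  have hqint : ∀ {y : ℝ}, 0 < y → Integrable (q y) τ := fun {y} hy => by
    have := (integrable_lkKernel (hoff hy) τ).im.const_mul y
    refine this.congr (Eventually.of_forall fun x => ?_)
    exact hq hy x
  have hlim2 : Tendsto (fun y : ℝ => b * y ^ 2 + ∫ x, q y x ∂τ) atTop (𝓝 1) := by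
    have h1 := ((Complex.continuous_re.tendsto _).comp hlim1).neg
    simp only [neg_re, one_re, neg_neg] at h1
    refine h1.congr' ?_
    filter_upwards [eventually_gt_atTop 0] with y hy
    have h2 : (∫ x, lkKernel x (y * I) ∂τ).im = ∫ x, (lkKernel x (y * I)).im ∂τ := by
      have := integral_im (𝕜 := ℂ) (integrable_lkKernel (hoff hy) τ)
      simp only [RCLike.im_to_complex] at this
      exact this.symm
    have h3 : y * (∫ x, lkKernel x (y * I) ∂τ).im = ∫ x, q y x ∂τ := by
      rw [h2, ← integral_const_mul]
      simp only [hq hy]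
    have h4 := hrep _ (hoff hy)
    beta_reduce at h4
    rw [Function.comp_apply, h4, ← h3]
    simp
    ring
  have hb0 : b = 0 := by
    by_contra hne
    have hbpos : 0 < b := lt_of_le_of_ne hb (Ne.symm hne)
    have h1 : Tendsto (fun y : ℝ => b * y ^ 2) atTop atTop :=
      (tendsto_pow_atTop two_ne_zero).const_mul_atTop hbpos
    have h2 := (hlim2.eventually (gt_mem_nhds (show (1 : ℝ) < 2 by norm_num))).and
      (h1.eventually_ge_atTop 2)
    obtain ⟨y, hy1, hy2⟩ := h2.exists
    have : 0 ≤ ∫ x, q y x ∂τ := integral_nonneg (hq0 y)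
    linarith
  subst hb0
  simp only [zero_mul, zero_add] at hlim2
  let d : ℝ → ℝ≥0 := fun x => (1 + x ^ 2).toNNReal
  have hdc : Continuous d := continuous_real_toNNReal.comp (by fun_prop)
  have hdx : ∀ x, (d x : ℝ) = 1 + x ^ 2 := fun x => Real.coe_toNNReal _ (by positivity)
  -- Monotone convergence along y = n + 1, which is positive from n = 0 on; the limit of the
  -- integrals is known from `hlim2`.
  have hmass : ∫⁻ x, (d x : ENNReal) ∂τ = 1 := by
    have hseq : Tendsto (fun n : ℕ => ∫⁻ x, ENNReal.ofReal (q ((n : ℝ) + 1) x) ∂τ) atTop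
        (𝓝 (∫⁻ x, (d x : ENNReal) ∂τ)) := by
      refine lintegral_tendsto_of_tendsto_of_monotone (fun n => ?_)
        (Eventually.of_forall fun x => ?_) (Eventually.of_forall fun x => ?_)
      · exact (hqint (by positivity)).aestronglyMeasurable.aemeasurable.ennreal_ofReal
      · intro m n hmn
        refine ENNReal.ofReal_le_ofReal ?_
        refine mul_le_mul_of_nonneg_left ?_ (by positivity)
        have hmn' : (m : ℝ) + 1 ≤ n + 1 := by exact_mod_cast Nat.succ_le_succ hmn
        have h5 : ((m : ℝ) + 1) ^ 2 ≤ ((n : ℝ) + 1) ^ 2 := by gcongr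
        rw [div_le_div_iff₀ (by positivity) (by positivity)]
        nlinarith [sq_nonneg x]
      · have h6 : Tendsto (fun n : ℕ => q ((n : ℝ) + 1) x) atTop (𝓝 ((1 + x ^ 2) * 1)) := by
          refine Tendsto.const_mul _ ?_
          have h7 : Tendsto (fun n : ℕ => ((n : ℝ) + 1) ^ 2) atTop atTop :=
            (tendsto_pow_atTop two_ne_zero).comp
              (tendsto_atTop_add_const_right _ _ tendsto_natCast_atTop_atTop)
          have h8 := (h7.const_div_atTop (x ^ 2)).add_const 1
          rw [zero_add] at h8
          have h9 := h8.inv₀ one_ne_zero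
          rw [inv_one] at h9
          refine h9.congr fun n => ?_
          have : ((n : ℝ) + 1) ^ 2 ≠ 0 := by positivity
          field_simp
        rw [mul_one] at h6
        exact (ENNReal.continuous_ofReal.tendsto _).comp h6
    have hseq2 : Tendsto (fun n : ℕ => ∫⁻ x, ENNReal.ofReal (q ((n : ℝ) + 1) x) ∂τ) atTop
        (𝓝 1) := by
      have h1 := (ENNReal.continuous_ofReal.tendsto _).comp (hlim2.comp
        (tendsto_atTop_add_const_right (atTop : Filter ℕ) (1 : ℝ) tendsto_natCast_atTop_atTop))
      rw [ENNReal.ofReal_one] at h1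
      refine h1.congr fun n => ?_
      exact ofReal_integral_eq_lintegral_ofReal (hqint (by positivity))
        (Eventually.of_forall (hq0 _))
    exact tendsto_nhds_unique hseq hseq2
  have hdint : Integrable (fun x => (d x : ℝ)) τ := by
    refine ⟨(NNReal.continuous_coe.comp hdc).aestronglyMeasurable, ?_⟩
    rw [hasFiniteIntegral_iff_enorm]
    simp [hmass]
  have hxint : Integrable (fun x : ℝ => (x : ℂ)) τ := by
    refine hdint.mono' Complex.continuous_ofReal.aestronglyMeasurable
      (Eventually.of_forall fun x => ?_)
    rw [hdx, norm_real, Real.norm_eq_abs]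
    nlinarith [sq_nonneg (|x| - 1), sq_abs x]
  let μ : Measure ℝ := τ.withDensity fun x => d x
  have hμ : IsProbabilityMeasure μ := ⟨by
    rw [withDensity_apply _ MeasurableSet.univ, Measure.restrict_univ, hmass]⟩
  have hG : ∀ z ∈ offReal, -(K z)⁻¹ = -(γ : ℂ) - (∫ x : ℝ, (x : ℂ) ∂τ) - cauchyTransform μ z := by
    intro z hz
    have h1 := hrep z hz
    simp only [ofReal_zero, zero_mul, add_zero] at h1
    rw [h1, cauchyTransform_eq_neg, integral_withDensity_eq_integral_smul hdc.measurable]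
    have h2 : ∀ x : ℝ, d x • (1 / ((x : ℂ) - z)) = lkKernel x z + x := fun x => by
      rw [lkKernel_add x hz, NNReal.smul_def, hdx, real_smul]
      push_cast
      ring
    simp only [h2]
    rw [integral_add (integrable_lkKernel hz τ) hxint]
    ring
  -- Multiplied by iy, the constant equals -iy/K(iy) + iy G(iy), which tends to -1 + 1 = 0, so it
  -- vanishes.
  have hc : -(γ : ℂ) - (∫ x : ℝ, (x : ℂ) ∂τ) = 0 := by
    have hinv : Tendsto (fun y : ℝ => ((y : ℂ) * I)⁻¹) atTop (𝓝 0) := by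
      have := ((Complex.continuous_ofReal.tendsto _).comp tendsto_inv_atTop_zero).mul_const I⁻¹
      simp only [ofReal_zero, zero_mul] at this
      refine this.congr fun y => ?_
      simp [mul_comm]
    have h1 := hinv.mul (hlim1.add (tendsto_mul_cauchyTransform μ))
    rw [zero_mul] at h1
    refine tendsto_nhds_unique (tendsto_const_nhds.congr' ?_) h1
    filter_upwards [eventually_gt_atTop 0] with y hy
    have hy' : (y : ℂ) * I ≠ 0 := mul_ne_zero (by exact_mod_cast hy.ne') I_ne_zero
    rw [← mul_add, inv_mul_cancel_left₀ hy', hG _ (hoff hy), sub_add_cancel]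
  refine ⟨μ, hμ, fun z hz => ?_⟩
  have h1 := hG z hz
  rw [hc, zero_sub, neg_inj] at h1
  rw [reciprocalCauchyTransform, ← h1, one_div, inv_inv]

lemma IsReciprocalCauchyTransform.conj_apply {K : ℂ → ℂ} (hK : IsReciprocalCauchyTransform K)
    {z : ℂ} (hz : z ∈ offReal) : K (conj z) = conj (K z) := by
  have := hK.isPick.conj_apply hz
  rw [map_sub] at this
  exact sub_left_injective this

lemma IsReciprocalCauchyTransform.mem_offReal {K : ℂ → ℂ} (hK : IsReciprocalCauchyTransform K)
    {z : ℂ} (hz : z ∈ offReal) : K z ∈ offReal := by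
  rcases lt_or_gt_of_ne hz with h | h
  · have h1 : 0 < (conj z).im := by simpa using h
    have h2 := hK.im_le h1
    rw [hK.conj_apply hz, conj_im (K z)] at h2
    intro h3
    linarith
  · exact mem_offReal_of_pos (h.trans_le (hK.im_le h))

/-! ### Pick cocycles and their generators -/

/-- A continuous function with a continuous right derivative is differentiable. -/
lemma hasDerivWithinAt_Ici_of_right {f φ : ℝ → ℂ} (hf : ContinuousOn f (Ici 0))
    (hφ : ContinuousOn φ (Ici 0))
    (h : ∀ t, 0 ≤ t → HasDerivWithinAt f (φ t) (Ici t) t) {t : ℝ} (ht : 0 ≤ t) :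
    HasDerivWithinAt f (φ t) (Ici 0) t := by
  let ψ : ℝ → ℂ := fun u => φ (max u 0)
  have hψ : Continuous ψ :=
    hφ.comp_continuous (continuous_id.max continuous_const) fun u => mem_Ici.2 (le_max_right _ _)
  have hψφ : ∀ u, 0 ≤ u → ψ u = φ u := fun u hu => by simp only [ψ, max_eq_left hu]
  let P : ℝ → ℂ := fun x => f 0 + ∫ u in (0 : ℝ)..x, ψ u
  have hP : ∀ x, HasDerivAt P (ψ x) x := fun x =>
    (intervalIntegral.integral_hasDerivAt_right (hψ.intervalIntegrable _ _)
      (hψ.stronglyMeasurableAtFilter _ _) hψ.continuousAt).const_add _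
  have heq : ∀ x, 0 ≤ x → f x = P x := fun x hx => by
    refine eq_of_has_deriv_right_eq (a := 0) (b := x) (f' := φ) (fun u hu => h u hu.1)
      (fun u hu => ?_) (hf.mono Icc_subset_Ici_self)
      (fun u _ => (hP u).continuousAt.continuousWithinAt) ?_ x (right_mem_Icc.2 hx)
    · rw [← hψφ u hu.1]
      exact (hP u).hasDerivWithinAt
    · simp [P]
  have := (hP t).hasDerivWithinAt (s := Ici 0)
  rw [hψφ t ht] at this
  exact this.congr (fun x hx => heq x hx) (heq t ht)

/-- An additive cocycle `k` of Pick functions over a continuous semigroup `F`. -/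
structure IsPickCocycle (F k : ℝ → ℂ → ℂ) : Prop where
  isPick : ∀ t, 0 ≤ t → IsPick (k t)
  zero : ∀ z ∈ offReal, k 0 z = 0
  continuousOn : ∀ z ∈ offReal, ContinuousOn (fun t => k t z) (Ici 0)
  add : ∀ t s, 0 ≤ t → 0 ≤ s → ∀ z ∈ offReal, k (t + s) z = k t (F s z) + k s z
  mem : ∀ t, 0 ≤ t → ∀ z ∈ offReal, F t z ∈ offReal
  flow_zero : ∀ z ∈ offReal, F 0 z = z
  flow_continuousOn : ∀ z ∈ offReal, ContinuousOn (fun t => F t z) (Ici 0)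

namespace IsPickCocycle

variable {F k : ℝ → ℂ → ℂ}

/-- Clamping time at 0 gives a function continuous on the whole line, to which the fundamental
theorem of calculus applies. -/
lemma continuous_max (h : IsPickCocycle F k) {z : ℂ} (hz : z ∈ offReal) :
    Continuous fun u : ℝ => k (max u 0) z :=
  (h.continuousOn z hz).comp_continuous (continuous_id.max continuous_const)
    fun _ => mem_Ici.2 (le_max_right _ _)

/-- Integrate k_{u+t}(z) = k_u(F_t z) + k_t(z) over u in [0, s]. The value k_t(z), not known to be
differentiable in t, is thereby traded for integrals that are, up to a remainder. -/
lemma integral_identity (h : IsPickCocycle F k) {z : ℂ} (hz : z ∈ offReal) {s t : ℝ} (hs : 0 ≤ s)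
    (ht : 0 ≤ t) :
    (s : ℂ) * k t z = ((∫ u in (0 : ℝ)..(s + t), k (max u 0) z) - ∫ u in (0 : ℝ)..s, k (max u 0) z)
      - (∫ u in (0 : ℝ)..t, k (max u 0) z)
      - ∫ u in (0 : ℝ)..s, (k (max u 0) (F t z) - k (max u 0) z) := by
  have hc := h.continuous_max hz
  have hc' := h.continuous_max (h.mem t ht z hz)
  have hi : ∀ a b, IntervalIntegrable (fun u : ℝ => k (max u 0) z) volume a b :=
    fun a b => hc.intervalIntegrable a b
  have hi' : ∀ a b, IntervalIntegrable (fun u : ℝ => k (max u 0) (F t z)) volume a b :=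
    fun a b => hc'.intervalIntegrable a b
  have e1 : ∫ u in (0 : ℝ)..s, k (max (u + t) 0) z =
      (∫ u in (0 : ℝ)..s, k (max u 0) (F t z)) + s * k t z := by
    have : ∫ u in (0 : ℝ)..s, k (max (u + t) 0) z =
        ∫ u in (0 : ℝ)..s, (k (max u 0) (F t z) + k t z) := by
      refine intervalIntegral.integral_congr fun u hu => ?_
      rw [uIcc_of_le hs] at hu
      rw [max_eq_left hu.1, max_eq_left (add_nonneg hu.1 ht), h.add u t hu.1 ht z hz]
    rw [this, intervalIntegral.integral_add (hi' _ _) (by simp), intervalIntegral.integral_const]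
    simp
  have e2 : ∫ u in (0 : ℝ)..s, k (max (u + t) 0) z = ∫ u in t..(s + t), k (max u 0) z := by
    rw [intervalIntegral.integral_comp_add_right (fun u => k (max u 0) z), zero_add]
  have e3 := intervalIntegral.integral_interval_sub_left (hi 0 (s + t)) (hi 0 t)
  rw [intervalIntegral.integral_sub (hi' _ _) (hi _ _)]
  rw [e2] at e1
  linear_combination -e1 - e3

/-- Divide `integral_identity` by st. As t → 0 the first three integrals contribute k_s(z)/s, since
k_0 = 0; the remainder is controlled by the Lipschitz bound for Pick functions. -/
lemma exists_slope_estimate (h : IsPickCocycle F k) {z : ℂ} (hz : z ∈ offReal) :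
    ∃ C : ℝ, 0 < C ∧ ∀ ε > 0, ∀ᶠ s : ℝ in 𝓝[>] 0, ∀ᶠ t : ℝ in 𝓝[>] 0,
      ‖k t z / t - k s z / s‖ ≤ ε + C * ε * ‖(F t z - z) / t‖ := by
  have hgap := pickGap_pos hz
  refine ⟨4 / (pickGap z * (pickGap z / 2)), by positivity, fun ε hε => ?_⟩
  -- Im k_u(i) governs the Lipschitz constant of k_u and is small for small u because k_0(i) = 0.
  have hsmall : ∀ᶠ s : ℝ in 𝓝[>] 0, ∀ u ∈ Icc 0 s, (k u I).im ≤ ε := by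
    have h1 : ContinuousWithinAt (fun t => (k t I).im) (Ici 0) 0 :=
      Complex.continuous_im.continuousAt.comp_continuousWithinAt
        (h.continuousOn I I_mem_offReal 0 self_mem_Ici)
    have h2 : ∀ᶠ u in 𝓝[≥] (0 : ℝ), (k u I).im < ε := by
      refine h1.eventually (gt_mem_nhds ?_)
      beta_reduce
      rwa [h.zero I I_mem_offReal, zero_im]
    obtain ⟨δ, hδ, hδ'⟩ := (mem_nhdsGE_iff_exists_Ico_subset).1 h2
    filter_upwards [Ioo_mem_nhdsGT hδ] with s hs u hu
    exact (hδ' ⟨hu.1, hu.2.trans_lt hs.2⟩).le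
  filter_upwards [hsmall, self_mem_nhdsWithin] with s hs hs0
  have hs0 : 0 < s := hs0
  have hc := h.continuous_max hz
  let Φ : ℝ → ℂ := fun x => ∫ u in (0 : ℝ)..x, k (max u 0) z
  have hΦ : ∀ x, HasDerivAt Φ (k (max x 0) z) x := fun x =>
    intervalIntegral.integral_hasDerivAt_right (hc.intervalIntegrable _ _)
      (hc.stronglyMeasurableAtFilter _ _) hc.continuousAt
  have l1 := (hΦ s).tendsto_slope_zero_right
  have l2 := (hΦ 0).tendsto_slope_zero_right
  rw [max_eq_left hs0.le] at l1
  rw [max_self, h.zero z hz] at l2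
  have l3 : Tendsto (fun t : ℝ => (s : ℂ)⁻¹ * (t⁻¹ • (Φ (s + t) - Φ s) - k s z
      - t⁻¹ • (Φ (0 + t) - Φ 0))) (𝓝[>] 0) (𝓝 0) := by
    simpa using ((l1.sub_const (k s z)).sub l2).const_mul (s : ℂ)⁻¹
  have l4 : ∀ᶠ t : ℝ in 𝓝[>] 0, pickGap z / 2 < pickGap (F t z) := by
    have h1 : ContinuousWithinAt (fun t => pickGap (F t z)) (Ici 0) 0 :=
      continuous_pickGap.continuousAt.comp_continuousWithinAt
        (h.flow_continuousOn z hz 0 self_mem_Ici)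
    have h2 : ∀ᶠ t in 𝓝[≥] (0 : ℝ), pickGap z / 2 < pickGap (F t z) := by
      refine h1.eventually (lt_mem_nhds ?_)
      beta_reduce
      rw [h.flow_zero z hz]
      exact half_lt_self hgap
    exact h2.filter_mono (nhdsWithin_mono _ Ioi_subset_Ici_self)
  filter_upwards [l4, self_mem_nhdsWithin,
    l3.norm.eventually (ge_mem_nhds (show ‖(0 : ℂ)‖ < ε by simpa using hε))] with t h4 ht h3
  have ht : 0 < t := ht
  have hFt := h.mem t ht.le z hz
  set R : ℂ := ∫ u in (0 : ℝ)..s, (k (max u 0) (F t z) - k (max u 0) z) with hR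
  have hRn : ‖R‖ ≤ 4 / (pickGap z * (pickGap z / 2)) * ‖F t z - z‖ * ε * s := by
    have : ∀ u ∈ uIoc (0 : ℝ) s, ‖k (max u 0) (F t z) - k (max u 0) z‖ ≤
        4 / (pickGap z * (pickGap z / 2)) * ‖F t z - z‖ * ε := fun u hu => by
      rw [uIoc_of_le hs0.le] at hu
      rw [max_eq_left hu.1.le]
      refine ((h.isPick u hu.1.le).norm_sub_le hFt hz).trans ?_
      have h5 := hs u ⟨hu.1.le, hu.2⟩
      have h6 : 0 ≤ (k u I).im := (h.isPick u hu.1.le).im_nonneg (by simp)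
      rw [mul_comm (pickGap (F t z))]
      gcongr
    have h7 := intervalIntegral.norm_integral_le_of_norm_le_const this
    rwa [sub_zero, abs_of_pos hs0] at h7
  have hid := h.integral_identity hz hs0.le ht.le
  have hsC : (s : ℂ) ≠ 0 := by exact_mod_cast hs0.ne'
  have htC : (t : ℂ) ≠ 0 := by exact_mod_cast ht.ne'
  have key : k t z / t - k s z / s = (s : ℂ)⁻¹ * (t⁻¹ • (Φ (s + t) - Φ s) - k s z
      - t⁻¹ • (Φ (0 + t) - Φ 0)) - R / (s * t) := by
    have hid' : (s : ℂ) * k t z = (Φ (s + t) - Φ s) - Φ t - R := hid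
    have hΦ0 : Φ 0 = 0 := intervalIntegral.integral_same
    rw [hΦ0, zero_add, real_smul, real_smul, ofReal_inv]
    field_simp
    linear_combination hid'
  rw [key]
  refine (norm_sub_le _ _).trans (add_le_add h3 ?_)
  rw [norm_div, norm_mul, norm_real, norm_real, norm_div, norm_real, Real.norm_of_nonneg hs0.le,
    Real.norm_of_nonneg ht.le, div_le_iff₀ (by positivity)]
  refine hRn.trans (le_of_eq ?_)
  field_simp

lemma exists_tendsto_of_bound (h : IsPickCocycle F k) {z : ℂ} (hz : z ∈ offReal) {M : ℝ}
    (hM : ∀ᶠ t : ℝ in 𝓝[>] 0, ‖(F t z - z) / t‖ ≤ M) :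
    ∃ a, Tendsto (fun t : ℝ => k t z / t) (𝓝[>] 0) (𝓝 a) := by
  obtain ⟨C, hC, hest⟩ := h.exists_slope_estimate hz
  have hM0 : 0 ≤ M := by
    obtain ⟨t, ht⟩ := hM.exists
    exact (norm_nonneg _).trans ht
  refine cauchy_map_iff_exists_tendsto.1 (Metric.cauchy_iff.2 ⟨inferInstance, fun δ hδ => ?_⟩)
  -- Chosen so that ε + CεM = δ/4.
  set ε := δ / (4 * (1 + C * M)) with hε
  have hCM : 0 < 1 + C * M := by positivity
  have hε0 : 0 < ε := by positivity
  obtain ⟨s, hs⟩ := (hest ε hε0).exists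
  refine ⟨Metric.ball (k s z / s) (δ / 2), ?_, fun x hx y hy => ?_⟩
  · refine mem_map.2 ?_
    filter_upwards [hs, hM] with t h1 h2
    rw [mem_preimage, Metric.mem_ball, dist_eq_norm]
    refine (h1.trans (add_le_add_right
      (mul_le_mul_of_nonneg_left h2 (by positivity)) _)).trans_lt ?_
    have : ε + C * ε * M = δ / 4 := by
      rw [hε]
      field_simp
    linarith
  · calc dist x y ≤ dist x (k s z / s) + dist y (k s z / s) := dist_triangle_right _ _ _
      _ < δ / 2 + δ / 2 := add_lt_add hx hy
      _ = δ := add_halves δ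

/-- For k = F - id the slope stands on both sides of the estimate; taking Cε = 1/2 lets half of it
be absorbed. -/
lemma exists_bound (h : IsPickCocycle F fun t z => F t z - z) {z : ℂ} (hz : z ∈ offReal) :
    ∃ M : ℝ, ∀ᶠ t : ℝ in 𝓝[>] 0, ‖(F t z - z) / t‖ ≤ M := by
  obtain ⟨C, hC, hest⟩ := h.exists_slope_estimate hz
  have hε0 : 0 < 1 / (2 * C) := by positivity
  obtain ⟨s, hs⟩ := (hest _ hε0).exists
  refine ⟨2 * (‖(F s z - z) / s‖ + 1 / (2 * C)), ?_⟩
  filter_upwards [hs] with t ht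
  have h1 := norm_sub_norm_le ((F t z - z) / t) ((F s z - z) / s)
  have h2 : C * (1 / (2 * C)) = 1 / 2 := by field_simp
  rw [h2] at ht
  linarith

/-- The infinitesimal generator of a cocycle. -/
lemma exists_generator (h : IsPickCocycle F k) (hF : IsPickCocycle F fun t z => F t z - z) :
    ∃ A : ℂ → ℂ, IsPick A ∧ ∀ z ∈ offReal,
      Tendsto (fun t : ℝ => k t z / t) (𝓝[>] 0) (𝓝 (A z)) := by
  have : ∀ z, ∃ a, z ∈ offReal → Tendsto (fun t : ℝ => k t z / t) (𝓝[>] 0) (𝓝 a) := fun z => by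
    by_cases hz : z ∈ offReal
    · obtain ⟨M, hM⟩ := hF.exists_bound hz
      obtain ⟨a, ha⟩ := h.exists_tendsto_of_bound hz hM
      exact ⟨a, fun _ => ha⟩
    · exact ⟨0, fun hz' => absurd hz' hz⟩
  choose A hA using this
  refine ⟨A, ?_, hA⟩
  refine IsPick.of_tendsto (l := 𝓝[>] (0 : ℝ)) (g := fun t z => k t z / t) ?_ hA
  filter_upwards [self_mem_nhdsWithin] with t ht
  have ht : 0 < t := ht
  have := (h.isPick t ht.le).smul (t⁻¹).toNNReal
  rw [Real.coe_toNNReal _ (inv_pos.2 ht).le] at this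
  convert this using 2 with z
  rw [ofReal_inv, div_eq_inv_mul]

/-- The cocycle relation turns the right derivative at time t into the one at time 0 at the point
F_t(z). It is continuous in t, hence a full derivative. -/
lemma hasDerivWithinAt (h : IsPickCocycle F k) {A : ℂ → ℂ} (hA : IsPick A)
    (hlim : ∀ z ∈ offReal, Tendsto (fun t : ℝ => k t z / t) (𝓝[>] 0) (𝓝 (A z)))
    {z : ℂ} (hz : z ∈ offReal) {t : ℝ} (ht : 0 ≤ t) :
    HasDerivWithinAt (fun t => k t z) (A (F t z)) (Ici 0) t := by
  refine hasDerivWithinAt_Ici_of_right (φ := fun t => A (F t z)) (h.continuousOn z hz)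
    (hA.differentiableOn.continuousOn.comp (h.flow_continuousOn z hz) fun u hu => h.mem u hu z hz)
    (fun t ht => ?_) ht
  rw [← hasDerivWithinAt_Ioi_iff_Ici, hasDerivWithinAt_iff_tendsto_slope' self_notMem_Ioi]
  have h1 := hlim _ (h.mem t ht z hz)
  have h2 : Tendsto (fun u : ℝ => u - t) (𝓝[>] t) (𝓝[>] 0) := by
    refine tendsto_nhdsWithin_iff.2 ⟨?_, ?_⟩
    · have : Tendsto (fun u : ℝ => u - t) (𝓝 t) (𝓝 (t - t)) := tendsto_id.sub_const t
      rw [sub_self] at this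
      exact this.mono_left nhdsWithin_le_nhds
    · filter_upwards [self_mem_nhdsWithin] with u hu using mem_Ioi.2 (sub_pos.2 (mem_Ioi.1 hu))
  refine (h1.comp h2).congr' ?_
  filter_upwards [self_mem_nhdsWithin] with u hu
  have hu : t < u := hu
  have h3 := h.add (u - t) t (sub_nonneg.2 hu.le) ht z hz
  rw [sub_add_cancel] at h3
  rw [slope_def_module, h3, add_sub_cancel_right, Function.comp_apply, real_smul, ofReal_inv,
    div_eq_inv_mul]

/-- The generator has no linear term at infinity. -/
lemma hasLevyKhintchineForm (h : IsPickCocycle F k) {A : ℂ → ℂ} (hA : IsPick A)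
    (hlim : ∀ z ∈ offReal, Tendsto (fun t : ℝ => k t z / t) (𝓝[>] 0) (𝓝 (A z)))
    (hF : ∀ t, 0 ≤ t → ∀ z : ℂ, 0 < z.im → z.im ≤ (F t z).im)
    (hk : Tendsto (fun y : ℝ => (k 1 (y * I) + y * I) / (y * I)) atTop (𝓝 1)) :
    HasLevyKhintchineForm A := by
  obtain ⟨γ, b, τ, hb, hτ, hrep⟩ := hA.exists_lkKernel
  have hAim : ∀ z : ℂ, 0 < z.im → b * z.im ≤ (A z).im := fun z hz => by
    have hp : IsPick fun z => ((0 : ℝ) : ℂ) + ∫ x, lkKernel x z ∂τ :=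
      isPick_of_integral_lkKernel 0 τ fun z _ => rfl
    have h1 := hp.im_nonneg hz
    rw [hrep z (mem_offReal_of_pos hz)]
    simp at h1 ⊢
    exact h1
  -- Along the flow Im A(F_t) ≥ b Im F_t ≥ by; integrate over [0, 1].
  have hgrow : ∀ y : ℝ, 0 < y → b * y ≤ (k 1 (y * I)).im := fun y hy => by
    have hy' : 0 < ((y : ℂ) * I).im := by simpa using hy
    have hyoff := mem_offReal_of_pos hy'
    have hder : ∀ t, 0 ≤ t → HasDerivWithinAt (fun t => (k t (y * I)).im - b * y * t)
        ((A (F t (y * I))).im - b * y) (Ici 0) t := fun t ht => by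
      have h1 := h.hasDerivWithinAt hA hlim hyoff ht
      have h2 : HasDerivWithinAt (fun t => (k t (y * I)).im) (A (F t (y * I))).im (Ici 0) t :=
        Complex.imCLM.hasFDerivAt.comp_hasDerivWithinAt t h1
      refine h2.sub ?_
      simpa using ((hasDerivAt_id t).const_mul (b * y)).hasDerivWithinAt
    have hmono : MonotoneOn (fun t => (k t (y * I)).im - b * y * t) (Ici 0) := by
      refine monotoneOn_of_hasDerivWithinAt_nonneg (convex_Ici 0)
        (fun t ht => (hder t ht).continuousWithinAt)
        (fun t ht => (hder t (interior_subset ht)).mono interior_subset) fun t ht => ?_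
      have ht0 : 0 ≤ t := interior_subset ht
      have h1 := hF t ht0 _ hy'
      have h2 := hAim _ (hy'.trans_le h1)
      have h3 : b * y ≤ b * (F t (y * I)).im := by
        refine mul_le_mul_of_nonneg_left ?_ hb
        simpa using h1
      linarith
    have := hmono (self_mem_Ici) (show (1 : ℝ) ∈ Ici 0 from mem_Ici.2 zero_le_one) zero_le_one
    simp only [h.zero _ hyoff] at this
    simp at this
    exact this
  have hb0 : b = 0 := by
    refine le_antisymm ?_ hb
    have h1 := (Complex.continuous_re.tendsto _).comp hk
    rw [one_re] at h1
    have h2 : 1 + b ≤ 1 := by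
      refine ge_of_tendsto h1 ?_
      filter_upwards [eventually_gt_atTop 0] with y hy
      have hy' : (y : ℂ) * I ≠ 0 := mul_ne_zero (by exact_mod_cast hy.ne') I_ne_zero
      have h3 : ((k 1 (y * I) + y * I) / (y * I)).re = 1 + (k 1 (y * I)).im / y := by
        rw [add_div, div_self hy', add_re, one_re, add_comm, mul_comm, ← div_div, div_I]
        rw [div_ofReal_re]
        simp
      rw [Function.comp_apply, h3]
      have := hgrow y hy
      rw [← le_div_iff₀ hy] at this
      linarith
    linarith
  subst hb0
  refine ⟨γ, τ, hτ, fun z hz => ?_⟩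
  rw [hrep z hz]
  simp [lkKernel]

end IsPickCocycle

/-! ### Generators of a c-monotone semigroup -/

namespace IsCMonotoneSemigroup

variable {H F : ℝ → ℂ → ℂ}

lemma isPickCocycle_right (h : IsCMonotoneSemigroup H F) :
    IsPickCocycle F fun t z => F t z - z where
  isPick t ht := (h.isReciprocal_right t ht).isPick
  zero z hz := by rw [h.zero_right z hz, sub_self]
  continuousOn z hz := (h.continuous_right z hz).sub continuousOn_const
  add t s ht hs z hz := by rw [h.add_right t s ht hs z hz, sub_add_sub_cancel]
  mem t ht z hz := (h.isReciprocal_right t ht).mem_offReal hz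
  flow_zero := h.zero_right
  flow_continuousOn := h.continuous_right

lemma isPickCocycle_left (h : IsCMonotoneSemigroup H F) :
    IsPickCocycle F fun t z => H t z - z where
  isPick t ht := (h.isReciprocal_left t ht).isPick
  zero z hz := by rw [h.zero_left z hz, sub_self]
  continuousOn z hz := (h.continuous_left z hz).sub continuousOn_const
  add t s ht hs z hz := by
    rw [h.add_left t s ht hs z hz]
    ring
  mem t ht z hz := (h.isReciprocal_right t ht).mem_offReal hz
  flow_zero := h.zero_right
  flow_continuousOn := h.continuous_right

theorem exists_generators (h : IsCMonotoneSemigroup H F) :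
    ∃ A₁ A₂ : ℂ → ℂ,
        AnalyticOnNhd ℂ A₁ offReal ∧ AnalyticOnNhd ℂ A₂ offReal ∧
        (∀ z ∈ offReal, SolvesFlow A₁ A₂ (fun t => H t z) (fun t => F t z)) ∧
        (∀ z ∈ offReal,
          HasDerivWithinAt (fun t : ℝ => H t z) (A₁ z) (Ici 0) 0 ∧
          HasDerivWithinAt (fun t : ℝ => F t z) (A₂ z) (Ici 0) 0) ∧
        HasLevyKhintchineForm A₁ ∧ HasLevyKhintchineForm A₂ := by
  obtain ⟨A₁, hA₁, hlim₁⟩ := h.isPickCocycle_left.exists_generator h.isPickCocycle_right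
  obtain ⟨A₂, hA₂, hlim₂⟩ := h.isPickCocycle_right.exists_generator h.isPickCocycle_right
  have hd₁ : ∀ z ∈ offReal, ∀ t, 0 ≤ t →
      HasDerivWithinAt (fun t : ℝ => H t z) (A₁ (F t z)) (Ici 0) t := fun z hz t ht => by
    simpa using (h.isPickCocycle_left.hasDerivWithinAt hA₁ hlim₁ hz ht).add_const z
  have hd₂ : ∀ z ∈ offReal, ∀ t, 0 ≤ t →
      HasDerivWithinAt (fun t : ℝ => F t z) (A₂ (F t z)) (Ici 0) t := fun z hz t ht => by
    simpa using (h.isPickCocycle_right.hasDerivWithinAt hA₂ hlim₂ hz ht).add_const z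
  refine ⟨A₁, A₂, hA₁.differentiableOn.analyticOnNhd isOpen_offReal,
    hA₂.differentiableOn.analyticOnNhd isOpen_offReal, fun z hz t ht =>
    ⟨(h.isReciprocal_right t ht).mem_offReal hz, hd₁ z hz t ht, hd₂ z hz t ht⟩,
    fun z hz => ?_, ?_, ?_⟩
  · have h1 := hd₁ z hz 0 le_rfl
    have h2 := hd₂ z hz 0 le_rfl
    rw [h.zero_right z hz] at h1 h2
    exact ⟨h1, h2⟩
  · refine h.isPickCocycle_left.hasLevyKhintchineForm hA₁ hlim₁
      (fun t ht z hz => (h.isReciprocal_right t ht).im_le hz) ?_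
    simpa using (h.isReciprocal_left 1 zero_le_one).tendsto
  · refine h.isPickCocycle_right.hasLevyKhintchineForm hA₂ hlim₂
      (fun t ht z hz => (h.isReciprocal_right t ht).im_le hz) ?_
    simpa using (h.isReciprocal_right 1 zero_le_one).tendsto

end IsCMonotoneSemigroup

/-! ### Straightening and global integral curves -/

lemma exists_primitive_upper {f : ℂ → ℂ} (hf : DifferentiableOn ℂ f {z | 0 < z.im}) :
    ∃ Ψ : ℂ → ℂ, ∀ z : ℂ, 0 < z.im → HasDerivAt Ψ (f z) z := by
  have hof : ∀ w : ℂ, ‖w‖ < 1 → HasDerivAt ofDisc (2 * I / (1 - w) ^ 2) w := fun w hw => by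
    have h1 := one_sub_ne_zero_of_norm_lt hw
    refine ((((hasDerivAt_id w).const_add 1).const_mul I).div
      ((hasDerivAt_id w).const_sub 1) h1).congr_deriv ?_
    simp only [id]
    congr 1
    ring
  have hto : ∀ z : ℂ, 0 < z.im → HasDerivAt toDisc (2 * I / (z + I) ^ 2) z := fun z hz => by
    refine (((hasDerivAt_id z).sub_const I).div ((hasDerivAt_id z).add_const I)
      (add_I_ne_zero hz)).congr_deriv ?_
    simp only [id]
    congr 1
    ring
  -- The form f dz is pulled back to the unit disc, a ball, where holomorphic functions have
  -- primitives.
  have hg : DifferentiableOn ℂ (fun w => f (ofDisc w) * (2 * I / (1 - w) ^ 2))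
      (Metric.ball 0 1) := by
    refine DifferentiableOn.mul (hf.comp (fun w hw => (hof w (by simpa using hw)).differentiableAt
      |>.differentiableWithinAt) fun w hw => ofDisc_im_pos (by simpa using hw)) ?_
    exact DifferentiableOn.div (by fun_prop) (by fun_prop) fun w hw =>
      pow_ne_zero 2 (one_sub_ne_zero_of_norm_lt (by simpa using hw))
  obtain ⟨P, hP⟩ := hg.isExactOn_ball
  refine ⟨P ∘ toDisc, fun z hz => ?_⟩
  refine ((hP (toDisc z) (by simpa using norm_toDisc_lt hz)).comp z (hto z hz)).congr_deriv ?_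
  have h1 := add_I_ne_zero hz
  have h2 : 1 - toDisc z = 2 * I / (z + I) := by
    rw [toDisc]
    field_simp
    ring
  beta_reduce
  rw [ofDisc_toDisc hz, h2]
  have := I_ne_zero
  field_simp

/-- The Noshiro–Warschawski criterion on the upper half-plane. -/
lemma injOn_upper {Ψ φ : ℂ → ℂ} (hΨ : ∀ z : ℂ, 0 < z.im → HasDerivAt Ψ (φ z) z) {u : ℂ}
    (hu : ∀ z : ℂ, 0 < z.im → 0 < (u * φ z).re) : InjOn Ψ {z | 0 < z.im} := by
  intro a ha b hb hab
  by_contra hne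
  have hba : b - a ≠ 0 := sub_ne_zero.2 (Ne.symm hne)
  let c : ℝ → ℂ := fun s => a + s * (b - a)
  have hc : ∀ s ∈ Icc (0 : ℝ) 1, 0 < (c s).im := fun s hs => by
    have : (c s).im = (1 - s) * a.im + s * b.im := by
      simp [c]
      ring
    rw [this]
    have ha : 0 < a.im := ha
    have hb : 0 < b.im := hb
    rcases hs.1.eq_or_lt with h | h
    · simpa [← h] using ha
    · have := mul_nonneg (sub_nonneg.2 hs.2) ha.le
      have := mul_pos h hb
      linarith
  -- Dividing by b - a cancels the velocity of the segment, leaving the positive quantity Re(uφ);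
  -- equal endpoint values are then impossible.
  have hd : ∀ s ∈ Icc (0 : ℝ) 1,
      HasDerivAt (fun s : ℝ => (u * Ψ (c s) / (b - a)).re) (u * φ (c s)).re s := fun s hs => by
    have h1 : HasDerivAt c (b - a) s := by
      exact (((hasDerivAt_id s).ofReal_comp.mul_const (b - a)).const_add a).congr_deriv (by simp)
    have h2 := (((hΨ _ (hc s hs)).comp s h1).const_mul u).div_const (b - a)
    have h3 := Complex.reCLM.hasFDerivAt.comp_hasDerivAt s h2
    refine h3.congr_deriv ?_
    simp only [reCLM_apply]
    congr 1
    field_simp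
  have hmono : StrictMonoOn (fun s : ℝ => (u * Ψ (c s) / (b - a)).re) (Icc 0 1) := by
    refine strictMonoOn_of_hasDerivWithinAt_pos (convex_Icc 0 1)
      (fun s hs => (hd s hs).continuousAt.continuousWithinAt)
      (fun s hs => (hd s (interior_subset hs)).hasDerivWithinAt)
      fun s hs => hu _ (hc s (interior_subset hs))
  have := hmono (left_mem_Icc.2 zero_le_one) (right_mem_Icc.2 zero_le_one) zero_lt_one
  simp [c, hab] at this

/-- Every kernel has positive imaginary part, so Im A can fail to be positive only if ν = 0. -/
lemma IsPick.im_pos_or_const {A : ℂ → ℂ} (hA : IsPick A) :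
    (∀ z : ℂ, 0 < z.im → 0 < (A z).im) ∨ ∃ γ : ℝ, ∀ z ∈ offReal, A z = γ := by
  obtain ⟨γ, ν, h⟩ := hA
  by_cases hν : ν = 0
  · right
    refine ⟨γ, fun z hz => ?_⟩
    rw [h z hz, hν]
    simp
  · left
    intro z hz
    have hz' := mem_offReal_of_pos hz
    have hpos : ∀ ζ : Circle, 0 < 4 * z.im / ‖pickDenom ζ z‖ ^ 2 := fun ζ => by
      have := norm_pos_iff.2 (pickDenom_ne_zero ζ hz')
      positivity
    have hint : Integrable (fun ζ : Circle => 4 * z.im / ‖pickDenom ζ z‖ ^ 2)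
        (ν : Measure Circle) := by
      have := (integrable_pickKernel hz' (ν : Measure Circle)).im
      refine this.congr (Eventually.of_forall fun ζ => ?_)
      exact pickKernel_im ζ hz'
    rw [h z hz', add_im, ofReal_im, zero_add, integral_pickKernel_im hz',
      integral_pos_iff_support_of_nonneg (fun ζ => (hpos ζ).le) hint]
    have : Function.support (fun ζ : Circle => 4 * z.im / ‖pickDenom ζ z‖ ^ 2) = univ := by
      ext ζ
      simpa using (hpos ζ).ne'
    rw [this, Measure.measure_univ_pos]
    intro h0
    exact hν (Subtype.ext h0)

/-- The hyperbolic speed along an integral curve of a Pick function does not increase, which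
bounds the curve. -/
lemma IsPick.integralCurve_bound {A : ℂ → ℂ} (hA : IsPick A) {c : ℝ → ℂ} {T : ℝ}
    (hc : ∀ s ∈ Ico 0 T, 0 < (c s).im) (hd : ∀ s ∈ Ico 0 T, HasDerivAt c (A (c s)) s)
    {s : ℝ} (hs : s ∈ Ico 0 T) :
    (c 0).im ≤ (c s).im ∧
    ‖c s - c 0‖ ≤ ‖A (c 0)‖ * Real.exp (‖A (c 0)‖ / (c 0).im * T) * s := by
  have h0 : (0 : ℝ) ∈ Ico 0 T := ⟨le_rfl, hs.1.trans_lt hs.2⟩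
  have hv0 := hc 0 h0
  set κ := ‖A (c 0)‖ / (c 0).im with hκ
  have hκ0 : 0 ≤ κ := by positivity
  have him : ∀ s ∈ Ico 0 T, HasDerivAt (fun s => (c s).im) (A (c s)).im s := fun s hs =>
    Complex.imCLM.hasFDerivAt.comp_hasDerivAt s (hd s hs)
  have hmono : MonotoneOn (fun s => (c s).im) (Ico 0 T) :=
    monotoneOn_of_hasDerivWithinAt_nonneg (convex_Ico 0 T)
      (fun s hs => (him s hs).continuousAt.continuousWithinAt)
      (fun s hs => (him s (interior_subset hs)).hasDerivWithinAt)
      fun s hs => hA.im_nonneg (hc s (interior_subset hs))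
  have hder : ∀ s ∈ Ico 0 T, HasDerivAt (fun s => A (c s)) (A (c s) * deriv A (c s)) s :=
    fun s hs => by
    have h1 : HasDerivAt A (deriv A (c s)) (c s) :=
      (hA.differentiableOn.differentiableAt
        (isOpen_offReal.mem_nhds (mem_offReal_of_pos (hc s hs)))).hasDerivAt
    have := h1.comp s (hd s hs)
    rwa [mul_comm] at this
  -- In the derivative of |A|²/(Im c)², the growth of |A| along the curve is at most |A| |A'|, and
  -- Schwarz–Pick bounds |A'| by Im A/Im c; the two terms then compensate.
  have hspeed : AntitoneOn (fun s => ‖A (c s)‖ ^ 2 / (c s).im ^ 2) (Ico 0 T) := by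
    have hd2 : ∀ s ∈ Ico 0 T, HasDerivAt (fun s => ‖A (c s)‖ ^ 2 / (c s).im ^ 2)
        ((2 * inner ℝ (A (c s)) (A (c s) * deriv A (c s)) * (c s).im ^ 2 -
          ‖A (c s)‖ ^ 2 * (2 * (c s).im * (A (c s)).im)) / ((c s).im ^ 2) ^ 2) s := fun s hs => by
      refine ((hder s hs).norm_sq.div ((him s hs).pow 2)
        (pow_ne_zero 2 (hc s hs).ne')).congr_deriv ?_
      simp
    refine antitoneOn_of_hasDerivWithinAt_nonpos (convex_Ico 0 T)
      (fun s hs => (hd2 s hs).continuousAt.continuousWithinAt)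
      (fun s hs => (hd2 s (interior_subset hs)).hasDerivWithinAt) fun s hs => ?_
    have hs' := interior_subset hs
    have hv := hc s hs'
    refine div_nonpos_of_nonpos_of_nonneg ?_ (by positivity)
    have h1 := hA.norm_deriv_le hv
    have h2 : inner ℝ (A (c s)) (A (c s) * deriv A (c s)) ≤
        ‖A (c s)‖ * (‖A (c s)‖ * ((A (c s)).im / (c s).im)) := by
      refine (real_inner_le_norm _ _).trans ?_
      rw [norm_mul]
      gcongr
    have h3 : ‖A (c s)‖ * (‖A (c s)‖ * ((A (c s)).im / (c s).im)) * (c s).im ^ 2 =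
        ‖A (c s)‖ ^ 2 * ((c s).im * (A (c s)).im) := by
      field_simp
    have h4 := mul_le_mul_of_nonneg_right h2 (sq_nonneg (c s).im)
    rw [h3] at h4
    linarith
  have hbound : ∀ s ∈ Ico 0 T, ‖A (c s)‖ ≤ κ * (c s).im := fun s hs => by
    have h1 := hspeed h0 hs hs.1
    have hv := hc s hs
    simp only [← div_pow] at h1
    have h2 := (pow_le_pow_iff_left₀ (by positivity) (by positivity) two_ne_zero).1 h1
    rwa [div_le_iff₀ hv] at h2
  -- Grönwall: (Im c)' = Im A(c) ≤ κ Im c.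
  have hexp : ∀ s ∈ Ico 0 T, (c s).im ≤ (c 0).im * Real.exp (κ * s) := fun s hs => by
    have hd3 : ∀ s ∈ Ico 0 T, HasDerivAt (fun s => (c s).im * Real.exp (-(κ * s)))
        ((A (c s)).im * Real.exp (-(κ * s)) + (c s).im * (Real.exp (-(κ * s)) * -(κ * 1))) s :=
      fun s hs => (him s hs).mul (((hasDerivAt_id s).const_mul κ).neg.exp)
    have hanti : AntitoneOn (fun s => (c s).im * Real.exp (-(κ * s))) (Ico 0 T) := by
      refine antitoneOn_of_hasDerivWithinAt_nonpos (convex_Ico 0 T)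
        (fun s hs => (hd3 s hs).continuousAt.continuousWithinAt)
        (fun s hs => (hd3 s (interior_subset hs)).hasDerivWithinAt) fun s hs => ?_
      have h1 := (le_abs_self _).trans ((abs_im_le_norm _).trans (hbound s (interior_subset hs)))
      have h2 := Real.exp_pos (-(κ * s))
      nlinarith
    have h1 := hanti h0 hs hs.1
    simp only [mul_zero, neg_zero, Real.exp_zero, mul_one, Real.exp_neg] at h1
    rwa [← div_eq_mul_inv, div_le_iff₀ (Real.exp_pos _)] at h1
  refine ⟨hmono h0 hs hs.1, ?_⟩
  have hsub : Icc 0 s ⊆ Ico 0 T := Icc_subset_Ico_right hs.2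
  have := norm_image_sub_le_of_norm_deriv_le_segment' (f := c) (a := 0) (b := s)
    (C := ‖A (c 0)‖ * Real.exp (κ * T)) (fun x hx => (hd x (hsub hx)).hasDerivWithinAt)
    (fun x hx => ?_) s (right_mem_Icc.2 hs.1)
  · simpa using this
  · have hx' := hsub (Ico_subset_Icc_self hx)
    refine (hbound x hx').trans ?_
    have h1 := mul_le_mul_of_nonneg_left (hexp x hx') hκ0
    have h2 : κ * ((c 0).im * Real.exp (κ * x)) = ‖A (c 0)‖ * Real.exp (κ * x) := by
      rw [hκ]
      field_simp
    rw [h2] at h1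
    refine h1.trans ?_
    have := hx'.2.le
    gcongr

/-! ### Flows on the upper half-plane -/

/-- A global flow on the upper half-plane for the equations `h' = A₁(f)`, `f' = A₂(f)`. -/
structure IsUpperFlow (A₁ A₂ : ℂ → ℂ) (H F : ℝ → ℂ → ℂ) : Prop where
  zero_right : ∀ z : ℂ, 0 < z.im → F 0 z = z
  zero_left : ∀ z : ℂ, 0 < z.im → H 0 z = z
  im_pos : ∀ t, 0 ≤ t → ∀ z : ℂ, 0 < z.im → 0 < (F t z).im
  deriv_right : ∀ t, 0 ≤ t → ∀ z : ℂ, 0 < z.im → HasDerivAt (fun t => F t z) (A₂ (F t z)) t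
  deriv_left : ∀ t, 0 ≤ t → ∀ z : ℂ, 0 < z.im → HasDerivAt (fun t => H t z) (A₁ (F t z)) t
  add_right : ∀ t s, 0 ≤ t → 0 ≤ s → ∀ z : ℂ, 0 < z.im → F (t + s) z = F t (F s z)
  add_left : ∀ t s, 0 ≤ t → 0 ≤ s → ∀ z : ℂ, 0 < z.im →
    H (t + s) z = H t (F s z) - F s z + H s z
  analytic_right : ∀ t, 0 ≤ t → ∀ z : ℂ, 0 < z.im →
    AnalyticAt ℝ (fun p : ℝ × ℂ => F p.1 p.2) (t, z)
  analytic_left : ∀ t, 0 ≤ t → ∀ z : ℂ, 0 < z.im →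
    AnalyticAt ℝ (fun p : ℝ × ℂ => H p.1 p.2) (t, z)
  differentiable_right : ∀ t, 0 ≤ t → DifferentiableOn ℂ (F t) {z | 0 < z.im}
  differentiable_left : ∀ t, 0 ≤ t → DifferentiableOn ℂ (H t) {z | 0 < z.im}
  unique : ∀ z : ℂ, 0 < z.im → ∀ f : ℝ → ℂ, f 0 = z → (∀ t, 0 ≤ t → 0 < (f t).im) →
    (∀ t, 0 ≤ t → HasDerivWithinAt f (A₂ (f t)) (Ici 0) t) → ∀ t, 0 ≤ t → f t = F t z

lemma eq_of_hasDerivWithinAt_Ici {f g φ : ℝ → ℂ}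
    (hf : ∀ t, 0 ≤ t → HasDerivWithinAt f (φ t) (Ici 0) t)
    (hg : ∀ t, 0 ≤ t → HasDerivWithinAt g (φ t) (Ici 0) t) (h0 : f 0 = g 0) {t : ℝ}
    (ht : 0 ≤ t) : f t = g t :=
  eq_of_has_deriv_right_eq (a := 0) (b := t) (f' := φ)
    (fun u hu => (hf u hu.1).mono (Ici_subset_Ici.2 hu.1))
    (fun u hu => (hg u hu.1).mono (Ici_subset_Ici.2 hu.1))
    (fun u hu => (hf u hu.1).continuousWithinAt.mono Icc_subset_Ici_self)
    (fun u hu => (hg u hu.1).continuousWithinAt.mono Icc_subset_Ici_self) h0 t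
    (right_mem_Icc.2 ht)

lemma isUpperFlow_of_zero {A₁ A₂ : ℂ → ℂ} (h₁ : DifferentiableOn ℂ A₁ {z | 0 < z.im})
    (h₂ : ∀ z : ℂ, 0 < z.im → A₂ z = 0) :
    IsUpperFlow A₁ A₂ (fun t z => z + t * A₁ z) fun _ z => z where
  zero_right _ _ := rfl
  zero_left z _ := by simp
  im_pos _ _ _ hz := hz
  deriv_right t _ z hz := by
    rw [h₂ z hz]
    exact hasDerivAt_const _ _
  deriv_left t _ z hz := by
    simpa using ((hasDerivAt_id t).ofReal_comp.mul_const (A₁ z)).const_add z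
  add_right _ _ _ _ _ _ := rfl
  add_left t s _ _ z _ := by
    push_cast
    ring
  analytic_right t _ z _ := analyticAt_snd
  analytic_left t _ z hz := by
    have h1 : AnalyticAt ℂ A₁ z := h₁.analyticAt (isOpen_upper.mem_nhds hz)
    have h2 : AnalyticAt ℝ (fun p : ℝ × ℂ => A₁ p.2) (t, z) :=
      (h1.restrictScalars (𝕜 := ℝ)).comp_of_eq analyticAt_snd rfl
    have h3 : AnalyticAt ℝ (fun p : ℝ × ℂ => (p.1 : ℂ)) (t, z) :=
      (Complex.ofRealCLM.analyticAt t).comp_of_eq analyticAt_fst rfl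
    exact analyticAt_snd.add (h3.mul h2)
  differentiable_right _ _ := differentiableOn_id
  differentiable_left t _ := differentiableOn_id.add (h₁.const_mul _)
  unique z hz f hf0 hfpos hf t ht := by
    refine eq_of_hasDerivWithinAt_Ici (φ := fun _ => 0) (fun t ht => ?_)
      (fun t _ => hasDerivWithinAt_const _ _ _) hf0 ht
    have := hf t ht
    rwa [h₂ _ (hfpos t ht)] at this

section Straightening

variable {A₁ A₂ Ψ Θ : ℂ → ℂ}

/-- The inverse of the straightening coordinate. -/
def upperInv (Ψ : ℂ → ℂ) : ℂ → ℂ := Function.invFunOn Ψ {z | 0 < z.im}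

lemma upperInv_apply (hinj : InjOn Ψ {z | 0 < z.im}) {z : ℂ} (hz : 0 < z.im) :
    upperInv Ψ (Ψ z) = z :=
  hinj.leftInvOn_invFunOn hz

lemma analyticAt_of_hasDerivAt_upper {φ : ℂ → ℂ}
    (hΨ : ∀ z : ℂ, 0 < z.im → HasDerivAt Ψ (φ z) z) {z : ℂ} (hz : 0 < z.im) :
    AnalyticAt ℂ Ψ z :=
  DifferentiableOn.analyticAt (s := {z | 0 < z.im})
    (fun w hw => (hΨ w hw).differentiableAt.differentiableWithinAt) (isOpen_upper.mem_nhds hz)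

/-- Near Ψ(z) the local inverse takes values in the half-plane, so injectivity identifies it with
`upperInv`. This transfers analyticity and the derivative, and shows the image of Ψ to be open. -/
lemma upperInv_local (hne : ∀ z : ℂ, 0 < z.im → A₂ z ≠ 0)
    (hΨ : ∀ z : ℂ, 0 < z.im → HasDerivAt Ψ (A₂ z)⁻¹ z) (hinj : InjOn Ψ {z | 0 < z.im}) {z : ℂ}
    (hz : 0 < z.im) :
    AnalyticAt ℂ (upperInv Ψ) (Ψ z) ∧ HasDerivAt (upperInv Ψ) (A₂ z) (Ψ z) ∧
      ∀ᶠ v in 𝓝 (Ψ z), v ∈ Ψ '' {z | 0 < z.im} := by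
  have han := analyticAt_of_hasDerivAt_upper hΨ hz
  have hd : deriv Ψ z ≠ 0 := by
    rw [(hΨ z hz).deriv]
    exact inv_ne_zero (hne z hz)
  have hL := han.analyticAt_localInverse hd
  have hLd := han.hasStrictDerivAt.to_localInverse hd
  have hr := han.hasStrictDerivAt.eventually_right_inverse hd
  set L := han.hasStrictDerivAt.localInverse _ _ _ hd with hLdef
  have hLz : L (Ψ z) = z := HasStrictFDerivAt.localInverse_apply_image ..
  have hpos : ∀ᶠ v in 𝓝 (Ψ z), 0 < (L v).im := by
    have : Tendsto L (𝓝 (Ψ z)) (𝓝 z) := by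
      have := hL.continuousAt.tendsto
      rwa [hLz] at this
    exact this.eventually (isOpen_upper.mem_nhds hz)
  have heq : L =ᶠ[𝓝 (Ψ z)] upperInv Ψ := by
    filter_upwards [hr, hpos] with v h1 h2
    conv_rhs => rw [← h1]
    exact (upperInv_apply hinj h2).symm
  refine ⟨hL.congr heq, ?_, ?_⟩
  · refine (hLd.hasDerivAt.congr_of_eventuallyEq heq.symm).congr_deriv ?_
    rw [(hΨ z hz).deriv, inv_inv]
  · filter_upwards [hr, hpos] with v h1 h2 using ⟨L v, h2, h1⟩

/-- Integral curves of a nonvanishing Pick function exist for all positive times. -/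
lemma add_mem_image (hA₂ : IsPick A₂) (hne : ∀ z : ℂ, 0 < z.im → A₂ z ≠ 0)
    (hΨ : ∀ z : ℂ, 0 < z.im → HasDerivAt Ψ (A₂ z)⁻¹ z) (hinj : InjOn Ψ {z | 0 < z.im}) {z : ℂ}
    (hz : 0 < z.im) {t : ℝ} (ht : 0 ≤ t) : Ψ z + t ∈ Ψ '' {z | 0 < z.im} := by
  by_contra hcon
  set V := Ψ '' {z : ℂ | 0 < z.im} with hV
  have hVo : IsOpen V := isOpen_iff_mem_nhds.2 fun v hv => by
    obtain ⟨w, hw, rfl⟩ := hv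
    exact (upperInv_local hne hΨ hinj hw).2.2
  have hshift : Continuous fun t : ℝ => Ψ z + t := by fun_prop
  let B : Set ℝ := {t | 0 ≤ t ∧ Ψ z + t ∉ V}
  have hB : IsClosed B := isClosed_Ici.inter (hVo.preimage hshift).isClosed_compl
  have hBb : BddBelow B := ⟨0, fun t ht => ht.1⟩
  -- First exit time of Ψ(z) + t from the image; it is attained since the image is open.
  set T := sInf B with hT
  have hTB : T ∈ B := hB.csInf_mem ⟨t, ht, hcon⟩ hBb
  have hlt : ∀ s ∈ Ico 0 T, Ψ z + s ∈ V := fun s hs => by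
    by_contra h
    exact (csInf_le hBb ⟨hs.1, h⟩).not_gt hs.2
  have hTpos : 0 < T := by
    refine lt_of_le_of_ne hTB.1 fun h => hTB.2 ?_
    rw [← h, ofReal_zero, add_zero]
    exact ⟨z, hz, rfl⟩
  let c : ℝ → ℂ := fun s => upperInv Ψ (Ψ z + s)
  have hcs : ∀ s ∈ Ico 0 T, 0 < (c s).im ∧ Ψ (c s) = Ψ z + s := fun s hs => by
    obtain ⟨w, hw, hw'⟩ := hlt s hs
    have : c s = w := by
      simp only [c]
      rw [← hw', upperInv_apply hinj hw]
    rw [this]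
    exact ⟨hw, hw'⟩
  have hc0 : c 0 = z := by
    simp only [c, ofReal_zero, add_zero]
    exact upperInv_apply hinj hz
  have hcd : ∀ s ∈ Ico 0 T, HasDerivAt c (A₂ (c s)) s := fun s hs => by
    have h1 := (upperInv_local hne hΨ hinj (hcs s hs).1).2.1
    rw [(hcs s hs).2] at h1
    have h2 : HasDerivAt (fun s : ℝ => Ψ z + (s : ℂ)) 1 s := by
      simpa using (hasDerivAt_id s).ofReal_comp.const_add (Ψ z)
    exact (h1.comp s h2).congr_deriv (mul_one _)
  -- Before T the curve stays in a compact part K of the half-plane. The image of K is closed, so it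
  -- contains Ψ(z) + T, a contradiction.
  set R := ‖A₂ z‖ * Real.exp (‖A₂ z‖ / z.im * T) * T with hR
  let K : Set ℂ := Metric.closedBall z R ∩ {w | z.im ≤ w.im}
  have hK : IsCompact K := (isCompact_closedBall z R).inter_right
    (isClosed_le continuous_const Complex.continuous_im)
  have hKU : K ⊆ {w | 0 < w.im} := fun w hw => hz.trans_le hw.2
  have hΨc : ContinuousOn Ψ K := fun w hw => (hΨ w (hKU hw)).continuousAt.continuousWithinAt
  have hcl : IsClosed (Ψ '' K) := (hK.image_of_continuousOn hΨc).isClosed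
  have hmem : ∀ s ∈ Ico 0 T, Ψ z + s ∈ Ψ '' K := fun s hs => by
    have h1 := hA₂.integralCurve_bound (fun s hs => (hcs s hs).1) hcd hs
    rw [hc0] at h1
    refine ⟨c s, ⟨?_, h1.1⟩, (hcs s hs).2⟩
    rw [mem_closedBall_iff_norm]
    refine h1.2.trans ?_
    have := hs.2.le
    rw [hR]
    gcongr
  have hlim : Tendsto (fun s : ℝ => Ψ z + s) (𝓝[<] T) (𝓝 (Ψ z + T)) :=
    (hshift.tendsto T).mono_left nhdsWithin_le_nhds
  have := hcl.mem_of_tendsto hlim (by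
    filter_upwards [Ico_mem_nhdsLT hTpos] with s hs using hmem s hs)
  exact hTB.2 (image_mono hKU this)

/-- In the coordinate Ψ the flow is translation by t, so the semigroup law and analyticity are
immediate; H is then a coboundary, as Θ' A₂ = A₁. -/
lemma isUpperFlow_of_ne_zero (hA₂ : IsPick A₂) (hne : ∀ z : ℂ, 0 < z.im → A₂ z ≠ 0)
    (hΨ : ∀ z : ℂ, 0 < z.im → HasDerivAt Ψ (A₂ z)⁻¹ z) (hinj : InjOn Ψ {z | 0 < z.im})
    (hΘ : ∀ z : ℂ, 0 < z.im → HasDerivAt Θ (A₁ z / A₂ z) z) :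
    IsUpperFlow A₁ A₂ (fun t z => z + Θ (upperInv Ψ (Ψ z + t)) - Θ z)
      fun t z => upperInv Ψ (Ψ z + t) := by
  have hF : ∀ t : ℝ, 0 ≤ t → ∀ z : ℂ, 0 < z.im →
      0 < (upperInv Ψ (Ψ z + t)).im ∧ Ψ (upperInv Ψ (Ψ z + t)) = Ψ z + t := fun t ht z hz => by
    obtain ⟨w, hw, hw'⟩ := add_mem_image hA₂ hne hΨ hinj hz ht
    rw [← hw', upperInv_apply hinj hw]
    exact ⟨hw, rfl⟩
  have han : ∀ t : ℝ, 0 ≤ t → ∀ z : ℂ, 0 < z.im →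
      AnalyticAt ℂ (upperInv Ψ) (Ψ z + t) := fun t ht z hz => by
    have := (upperInv_local hne hΨ hinj (hF t ht z hz).1).1
    rwa [(hF t ht z hz).2] at this
  have hd : ∀ t : ℝ, 0 ≤ t → ∀ z : ℂ, 0 < z.im →
      HasDerivAt (fun t : ℝ => upperInv Ψ (Ψ z + t)) (A₂ (upperInv Ψ (Ψ z + t))) t :=
    fun t ht z hz => by
    have h1 := (upperInv_local hne hΨ hinj (hF t ht z hz).1).2.1
    rw [(hF t ht z hz).2] at h1
    have h2 : HasDerivAt (fun s : ℝ => Ψ z + (s : ℂ)) 1 t := by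
      simpa using (hasDerivAt_id t).ofReal_comp.const_add (Ψ z)
    exact (h1.comp t h2).congr_deriv (mul_one _)
  have hadd : ∀ t s : ℝ, 0 ≤ s → ∀ z : ℂ, 0 < z.im →
      upperInv Ψ (Ψ z + ((t + s : ℝ) : ℂ)) = upperInv Ψ (Ψ (upperInv Ψ (Ψ z + s)) + t) :=
    fun t s hs z hz => by
    rw [(hF s hs z hz).2]
    push_cast
    ring_nf
  have hanF : ∀ t, 0 ≤ t → ∀ z : ℂ, 0 < z.im →
      AnalyticAt ℝ (fun p : ℝ × ℂ => upperInv Ψ (Ψ p.2 + p.1)) (t, z) := fun t ht z hz => by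
    have h2 : AnalyticAt ℝ (fun p : ℝ × ℂ => Ψ p.2) (t, z) :=
      ((analyticAt_of_hasDerivAt_upper hΨ hz).restrictScalars (𝕜 := ℝ)).comp_of_eq
        analyticAt_snd rfl
    have h3 : AnalyticAt ℝ (fun p : ℝ × ℂ => (p.1 : ℂ)) (t, z) :=
      (Complex.ofRealCLM.analyticAt t).comp_of_eq analyticAt_fst rfl
    exact ((han t ht z hz).restrictScalars (𝕜 := ℝ)).comp_of_eq (h2.add h3) rfl
  have hdF : ∀ t : ℝ, 0 ≤ t →
      DifferentiableOn ℂ (fun z => upperInv Ψ (Ψ z + t)) {z | 0 < z.im} := fun t ht z hz => by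
    have h1 : DifferentiableAt ℂ (fun z => Ψ z + (t : ℂ)) z :=
      (hΨ z hz).differentiableAt.add_const _
    exact ((han t ht z hz).differentiableAt.comp z h1).differentiableWithinAt
  refine
    { zero_right := fun z hz => ?_
      zero_left := fun z hz => ?_
      im_pos := fun t ht z hz => (hF t ht z hz).1
      deriv_right := hd
      deriv_left := fun t ht z hz => ?_
      add_right := fun t s _ hs z hz => hadd t s hs z hz
      add_left := fun t s _ hs z hz => ?_
      analytic_right := hanF
      analytic_left := fun t ht z hz => ?_
      differentiable_right := hdF
      differentiable_left := fun t ht => ?_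
      unique := fun z hz f hf0 hfpos hf t ht => ?_ }
  · rw [ofReal_zero, add_zero, upperInv_apply hinj hz]
  · rw [ofReal_zero, add_zero, upperInv_apply hinj hz, add_sub_cancel_right]
  · have h1 := (((hΘ _ (hF t ht z hz).1).comp t (hd t ht z hz)).const_add z).sub_const (Θ z)
    refine h1.congr_deriv ?_
    exact div_mul_cancel₀ _ (hne _ (hF t ht z hz).1)
  · rw [hadd t s hs z hz]
    ring
  · have h1 : AnalyticAt ℝ (fun p : ℝ × ℂ => Θ p.2) (t, z) :=
      ((analyticAt_of_hasDerivAt_upper hΘ hz).restrictScalars (𝕜 := ℝ)).comp_of_eq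
        analyticAt_snd rfl
    have h2 := ((analyticAt_of_hasDerivAt_upper hΘ (hF t ht z hz).1).restrictScalars
      (𝕜 := ℝ)).comp_of_eq (hanF t ht z hz) rfl
    exact (analyticAt_snd.add h2).sub h1
  · have h1 : DifferentiableOn ℂ Θ {z | 0 < z.im} := fun z hz =>
      (hΘ z hz).differentiableAt.differentiableWithinAt
    exact (differentiableOn_id.add (h1.comp (hdF t ht) fun z hz => (hF t ht z hz).1)).sub h1
  -- Any solution moves at unit speed in the coordinate Ψ.
  · have h1 : Ψ (f t) = Ψ z + t := by
      refine eq_of_hasDerivWithinAt_Ici (f := fun t => Ψ (f t)) (g := fun t : ℝ => Ψ z + t)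
        (φ := fun _ => 1) (fun s hs => ?_) (fun s _ => ?_) (by simp [hf0]) ht
      · refine ((hΨ _ (hfpos s hs)).comp_hasDerivWithinAt s (hf s hs)).congr_deriv ?_
        exact inv_mul_cancel₀ (hne _ (hfpos s hs))
      · simpa using ((hasDerivAt_id s).ofReal_comp.const_add (Ψ z)).hasDerivWithinAt
    rw [← h1, upperInv_apply hinj (hfpos t ht)]

end Straightening

theorem exists_isUpperFlow {A₁ A₂ : ℂ → ℂ} (h₁ : IsPick A₁) (h₂ : IsPick A₂) :
    ∃ H F, IsUpperFlow A₁ A₂ H F := by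
  have hd₁ := h₁.differentiableOn.mono upper_subset_offReal
  have hd₂ := h₂.differentiableOn.mono upper_subset_offReal
  have main : ∀ u : ℂ, (∀ z : ℂ, 0 < z.im → A₂ z ≠ 0) →
      (∀ z : ℂ, 0 < z.im → 0 < (u * (A₂ z)⁻¹).re) → ∃ H F, IsUpperFlow A₁ A₂ H F :=
    fun u hne hu => by
    obtain ⟨Ψ, hΨ⟩ := exists_primitive_upper (hd₂.inv hne)
    obtain ⟨Θ, hΘ⟩ := exists_primitive_upper (hd₁.div hd₂ hne)
    exact ⟨_, _, isUpperFlow_of_ne_zero h₂ hne hΨ (injOn_upper hΨ hu) hΘ⟩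
  rcases h₂.im_pos_or_const with hpos | ⟨γ, hγ⟩
  · refine main I (fun z hz h => ?_) fun z hz => ?_
    · have := hpos z hz
      rw [h, zero_im] at this
      exact lt_irrefl _ this
    · have h1 := hpos z hz
      have h2 : 0 < normSq (A₂ z) := normSq_pos.2 fun h => by
        rw [h, zero_im] at h1
        exact lt_irrefl _ h1
      have : (I * (A₂ z)⁻¹).re = (A₂ z).im / normSq (A₂ z) := by
        simp [inv_im, neg_div]
      rw [this]
      positivity
  · by_cases h0 : γ = 0
    · refine ⟨_, _, isUpperFlow_of_zero hd₁ fun z hz => ?_⟩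
      rw [hγ z (mem_offReal_of_pos hz), h0, ofReal_zero]
    · have h0' : (γ : ℂ) ≠ 0 := by exact_mod_cast h0
      refine main γ (fun z hz => ?_) fun z hz => ?_
      · rwa [hγ z (mem_offReal_of_pos hz)]
      · rw [hγ z (mem_offReal_of_pos hz), mul_inv_cancel₀ h0']
        simp

/-! ### Behaviour at infinity along the imaginary axis -/

lemma norm_lkKernel_le {y : ℝ} (hy : 0 < y) {w : ℂ} (hw : ‖w - y * I‖ ≤ y / 2) (x : ℝ) :
    ‖lkKernel x w‖ ≤ y * (6 * ((1 + 2 * y * |x|) / ((|x| + y) * y))) := by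
  have h1 : ‖w‖ ≤ 3 / 2 * y := by
    have := norm_add_le (w - y * I) (y * I)
    rw [sub_add_cancel, norm_mul, norm_I, norm_real, Real.norm_of_nonneg hy.le] at this
    linarith
  have h2 : y / 2 ≤ w.im := by
    have := (abs_le.1 ((abs_im_le_norm _).trans hw)).1
    simp at this
    linarith
  have h3 : y / 2 ≤ ‖(x : ℂ) - w‖ := by
    have := neg_le_abs _ |>.trans (abs_im_le_norm ((x : ℂ) - w))
    simp at this
    linarith
  have h4 : |x| - 3 / 2 * y ≤ ‖(x : ℂ) - w‖ := by
    have := norm_sub_norm_le (x : ℂ) w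
    rw [norm_real, Real.norm_eq_abs] at this
    linarith
  -- Five sixths of `h3` plus one sixth of `h4`.
  have h5 : (|x| + y) / 6 ≤ ‖(x : ℂ) - w‖ := by linarith
  have h6 : ‖1 + (x : ℂ) * w‖ ≤ 1 + 2 * y * |x| := by
    refine (norm_add_le _ _).trans ?_
    rw [norm_one, norm_mul, norm_real, Real.norm_eq_abs]
    nlinarith [abs_nonneg x]
  have h7 : 0 < |x| + y := by positivity
  calc ‖lkKernel x w‖ = ‖1 + (x : ℂ) * w‖ / ‖(x : ℂ) - w‖ := norm_div _ _
    _ ≤ (1 + 2 * y * |x|) / ((|x| + y) / 6) := by gcongr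
    _ = y * (6 * ((1 + 2 * y * |x|) / ((|x| + y) * y))) := by
      field_simp

/-- A function of Lévy–Khintchine form is sublinear near the imaginary axis. -/
lemma HasLevyKhintchineForm.eventually_norm_le {A : ℂ → ℂ} (hA : HasLevyKhintchineForm A) {ε : ℝ}
    (hε : 0 < ε) :
    ∀ᶠ y : ℝ in atTop, ∀ w : ℂ, ‖w - y * I‖ ≤ y / 2 → ‖A w‖ ≤ ε * y := by
  obtain ⟨γ, τ, hτ, hrep⟩ := hA
  -- `y * q y x` dominates the kernel near iy, while `q` is bounded and tends to 0 for each x;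
  -- dominated convergence makes the integral o(y).
  let q : ℝ → ℝ → ℝ := fun y x => 6 * ((1 + 2 * y * |x|) / ((|x| + y) * y))
  have hq : ∀ {y : ℝ}, 0 < y → ∀ x, q y x = 6 * (y⁻¹ / (|x| + y) + 2 * |x| / (|x| + y)) :=
    fun {y} hy x => by
    have : 0 < |x| + y := by positivity
    simp only [q]
    field_simp
  have hq1 : ∀ {y : ℝ}, 1 ≤ y → ∀ x, ‖q y x‖ ≤ 18 := fun {y} hy x => by
    have hy0 : 0 < y := by linarith
    have h0 : 0 < |x| + y := by positivity
    have h1 : y⁻¹ / (|x| + y) ≤ 1 := by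
      rw [div_le_one h0]
      have := inv_le_one_of_one_le₀ hy
      have := abs_nonneg x
      linarith
    have h2 : 2 * |x| / (|x| + y) ≤ 2 := by
      rw [div_le_iff₀ h0]
      linarith
    rw [Real.norm_of_nonneg (by positivity), hq hy0]
    linarith
  have hqm : ∀ {y : ℝ}, 0 < y → AEStronglyMeasurable (q y) τ := fun {y} hy => by
    have : Continuous (q y) := by
      refine Continuous.const_mul (Continuous.div (by fun_prop) (by fun_prop) fun x => ?_) _
      positivity
    exact this.aestronglyMeasurable
  have hlim : Tendsto (fun y => ∫ x, q y x ∂τ) atTop (𝓝 0) := by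
    have h0 : (0 : ℝ) = ∫ _ : ℝ, (0 : ℝ) ∂τ := by simp
    rw [h0]
    refine tendsto_integral_filter_of_dominated_convergence (fun _ => 18) ?_ ?_
      (integrable_const _) (Eventually.of_forall fun x => ?_)
    · filter_upwards [eventually_gt_atTop 0] with y hy using hqm hy
    · filter_upwards [eventually_ge_atTop 1] with y hy using Eventually.of_forall (hq1 hy)
    · have h1 : Tendsto (fun y : ℝ => |x| + y) atTop atTop :=
        tendsto_atTop_add_const_left _ _ tendsto_id
      have h2 : Tendsto (fun y : ℝ => 6 * (y⁻¹ / (|x| + y) + 2 * |x| / (|x| + y))) atTop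
          (𝓝 (6 * (0 + 0))) :=
        ((tendsto_inv_atTop_zero.div_atTop h1).add (h1.const_div_atTop _)).const_mul 6
      simp only [add_zero, mul_zero] at h2
      refine h2.congr' ?_
      filter_upwards [eventually_gt_atTop 0] with y hy using (hq hy x).symm
  have hlim2 : Tendsto (fun y : ℝ => |γ| / y + ∫ x, q y x ∂τ) atTop (𝓝 0) := by
    simpa using (tendsto_id.const_div_atTop |γ|).add hlim
  filter_upwards [hlim2.eventually (ge_mem_nhds hε), eventually_ge_atTop 1] with y h1 hy w hw
  have hy0 : 0 < y := by linarith
  have him : 0 < w.im := by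
    have := (abs_le.1 ((abs_im_le_norm _).trans hw)).1
    simp at this
    linarith
  have hqi : Integrable (q y) τ :=
    Integrable.of_bound (hqm hy0) _ (Eventually.of_forall (hq1 hy))
  have h2 : ‖∫ x, lkKernel x w ∂τ‖ ≤ ∫ x, y * q y x ∂τ :=
    norm_integral_le_of_norm_le (hqi.const_mul y)
      (Eventually.of_forall fun x => norm_lkKernel_le hy0 hw x)
  rw [hrep w (mem_offReal_of_pos him)]
  calc ‖-(γ : ℂ) + ∫ x : ℝ, (1 + (x : ℂ) * w) / ((x : ℂ) - w) ∂τ‖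
      ≤ |γ| + ∫ x, y * q y x ∂τ := by
        refine (norm_add_le _ _).trans (add_le_add ?_ h2)
        rw [norm_neg, norm_real, Real.norm_eq_abs]
    _ = (|γ| / y + ∫ x, q y x ∂τ) * y := by
        rw [integral_const_mul]
        field_simp
    _ ≤ ε * y := by gcongr

namespace IsUpperFlow

variable {A₁ A₂ : ℂ → ℂ} {H F : ℝ → ℂ → ℂ}

lemma bound (h : IsUpperFlow A₁ A₂ H F) (h₂ : IsPick A₂) {z : ℂ} (hz : 0 < z.im) {s t : ℝ}
    (hs : 0 ≤ s) (hst : s ≤ t) :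
    z.im ≤ (F s z).im ∧
      ‖F s z - z‖ ≤ ‖A₂ z‖ * Real.exp (‖A₂ z‖ / z.im * (t + 1)) * s := by
  -- The curve bound lives on a half-open interval; T = t + 1 brings s = t inside.
  have := h₂.integralCurve_bound (c := fun t => F t z) (T := t + 1)
    (fun s hs => h.im_pos s hs.1 z hz) (fun s hs => h.deriv_right s hs.1 z hz)
    (s := s) ⟨hs, by linarith⟩
  simp only [h.zero_right z hz] at this
  exact this

lemma im_le_left (h : IsUpperFlow A₁ A₂ H F) (h₁ : IsPick A₁) {z : ℂ} (hz : 0 < z.im) {t : ℝ}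
    (ht : 0 ≤ t) : z.im ≤ (H t z).im := by
  have hder : ∀ t, 0 ≤ t → HasDerivAt (fun t => (H t z).im) (A₁ (F t z)).im t := fun t ht =>
    Complex.imCLM.hasFDerivAt.comp_hasDerivAt t (h.deriv_left t ht z hz)
  have hmono : MonotoneOn (fun t => (H t z).im) (Ici 0) := by
    refine monotoneOn_of_hasDerivWithinAt_nonneg (convex_Ici 0)
      (fun t ht => (hder t ht).continuousAt.continuousWithinAt)
      (fun t ht => (hder t (interior_subset ht)).hasDerivWithinAt) fun t ht => ?_
    exact h₁.im_nonneg (h.im_pos t (interior_subset ht) z hz)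
  have := hmono self_mem_Ici (mem_Ici.2 ht) ht
  simpa only [h.zero_left z hz] using this

lemma eventually_norm_sub_le (h : IsUpperFlow A₁ A₂ H F) (h₂ : HasLevyKhintchineForm A₂) {t : ℝ}
    (ht : 0 ≤ t) {ε : ℝ} (hε : 0 < ε) :
    ∀ᶠ y : ℝ in atTop, ∀ s ∈ Icc 0 t, ‖F s (y * I) - y * I‖ ≤ ε * y := by
  -- The bound 1 caps the exponential factor at exp(t + 1); the second bound then yields εy.
  set η : ℝ := min 1 (ε / (Real.exp (t + 1) * (t + 1))) with hη
  have hη0 : 0 < η := lt_min one_pos (by positivity)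
  filter_upwards [h₂.eventually_norm_le hη0, eventually_gt_atTop 0] with y hy1 hy s hs
  have hA := hy1 (y * I) (by simpa using (half_pos hy).le)
  have him : ((y : ℂ) * I).im = y := by simp
  have h1 := (h.bound h₂.isPick (z := y * I) (by rwa [him]) hs.1 hs.2).2
  rw [him] at h1
  have h3 : ‖A₂ (y * I)‖ / y ≤ 1 := by
    rw [div_le_one hy]
    exact hA.trans (by nlinarith [min_le_left 1 (ε / (Real.exp (t + 1) * (t + 1)))])
  have h4 : Real.exp (‖A₂ (y * I)‖ / y * (t + 1)) ≤ Real.exp (t + 1) := by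
    refine Real.exp_le_exp.2 ?_
    nlinarith
  calc ‖F s (y * I) - y * I‖
      ≤ ‖A₂ (y * I)‖ * Real.exp (‖A₂ (y * I)‖ / y * (t + 1)) * s := h1
    _ ≤ (ε / (Real.exp (t + 1) * (t + 1)) * y) * Real.exp (t + 1) * (t + 1) := by
        have h5 : ‖A₂ (y * I)‖ ≤ ε / (Real.exp (t + 1) * (t + 1)) * y :=
          hA.trans (mul_le_mul_of_nonneg_right (min_le_right _ _) hy.le)
        have h6 : s ≤ t + 1 := by linarith [hs.2]
        have h7 := hs.1
        gcongr
    _ = ε * y := by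
        field_simp

lemma tendsto_of_eventually_norm_sub_le {K : ℂ → ℂ}
    (hK : ∀ ε : ℝ, 0 < ε → ∀ᶠ y : ℝ in atTop, ‖K (y * I) - y * I‖ ≤ ε * y) :
    Tendsto (fun y : ℝ => K (y * I) / (y * I)) atTop (𝓝 1) := by
  rw [Metric.tendsto_nhds]
  intro ε hε
  filter_upwards [hK (ε / 2) (half_pos hε), eventually_gt_atTop 0] with y h1 hy
  have hy' : (y : ℂ) * I ≠ 0 := mul_ne_zero (by exact_mod_cast hy.ne') I_ne_zero
  rw [dist_eq_norm, div_sub_one hy', norm_div, norm_mul, norm_I, norm_real,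
    Real.norm_of_nonneg hy.le, mul_one, div_lt_iff₀ hy]
  nlinarith

lemma tendsto_right (h : IsUpperFlow A₁ A₂ H F) (h₂ : HasLevyKhintchineForm A₂) {t : ℝ}
    (ht : 0 ≤ t) : Tendsto (fun y : ℝ => F t (y * I) / (y * I)) atTop (𝓝 1) :=
  tendsto_of_eventually_norm_sub_le fun _ hε =>
    (h.eventually_norm_sub_le h₂ ht hε).mono fun _ hy => hy t ⟨ht, le_rfl⟩

lemma tendsto_left (h : IsUpperFlow A₁ A₂ H F) (h₁ : HasLevyKhintchineForm A₁)
    (h₂ : HasLevyKhintchineForm A₂) {t : ℝ} (ht : 0 ≤ t) :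
    Tendsto (fun y : ℝ => H t (y * I) / (y * I)) atTop (𝓝 1) := by
  refine tendsto_of_eventually_norm_sub_le fun ε hε => ?_
  have hε' : 0 < ε / (t + 1) := by positivity
  -- Up to time t the curve F stays within y/2 of iy, where A₁ is sublinear; integrate H' = A₁(F).
  filter_upwards [h.eventually_norm_sub_le h₂ ht one_half_pos, h₁.eventually_norm_le hε',
    eventually_gt_atTop 0] with y h3 h4 hy
  have him : 0 < ((y : ℂ) * I).im := by simpa using hy
  have := norm_image_sub_le_of_norm_deriv_le_segment' (f := fun s => H s (y * I)) (a := 0) (b := t)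
    (C := ε / (t + 1) * y) (fun s hs => (h.deriv_left s hs.1 _ him).hasDerivWithinAt)
    (fun s hs => h4 _ ((h3 s ⟨hs.1, hs.2.le⟩).trans (by linarith))) t (right_mem_Icc.2 ht)
  rw [h.zero_left _ him, sub_zero] at this
  refine this.trans ?_
  rw [mul_right_comm, div_mul_eq_mul_div]
  refine mul_le_mul_of_nonneg_right ?_ hy.le
  rw [div_le_iff₀ (by positivity)]
  nlinarith

end IsUpperFlow

/-! ### Reflection to the lower half-plane and uniqueness -/

/-- Extension from the upper half-plane by symmetry. -/
def reflect (g : ℂ → ℂ) (z : ℂ) : ℂ := if 0 < z.im then g z else conj (g (conj z))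

lemma reflect_of_pos (g : ℂ → ℂ) {z : ℂ} (hz : 0 < z.im) : reflect g z = g z := if_pos hz

lemma reflect_of_neg (g : ℂ → ℂ) {z : ℂ} (hz : z.im < 0) : reflect g z = conj (g (conj z)) :=
  if_neg hz.not_gt

lemma isReciprocalCauchyTransform_reflect {K : ℂ → ℂ}
    (hd : DifferentiableOn ℂ K {z | 0 < z.im})
    (him : ∀ z : ℂ, 0 < z.im → z.im ≤ (K z).im)
    (hlim : Tendsto (fun y : ℝ => K (y * I) / (y * I)) atTop (𝓝 1)) :
    IsReciprocalCauchyTransform (reflect K) := by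
  refine isReciprocalCauchyTransform_of (hd.congr fun z hz => reflect_of_pos K hz)
    (fun z hz => ?_) (fun z hz => ?_) (hlim.congr' ?_)
  · rw [reflect_of_pos K hz]
    exact him z hz
  · rw [reflect_of_pos K hz, reflect_of_neg K (by simpa using hz), conj_conj]
  · filter_upwards [eventually_gt_atTop 0] with y hy
    rw [reflect_of_pos K (by simpa using hy)]

/-- By the intermediate value theorem a curve avoiding the real axis keeps its half-plane;
uniqueness for the upper flow then applies to arbitrary solutions. -/
lemma im_pos_of_mem_offReal {f : ℝ → ℂ} (hf : ContinuousOn f (Ici 0))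
    (hoff : ∀ t, 0 ≤ t → f t ∈ offReal) (h0 : 0 < (f 0).im) {t : ℝ} (ht : 0 ≤ t) :
    0 < (f t).im := by
  by_contra hcon
  have hc : ContinuousOn (fun t => (f t).im) (Icc 0 t) :=
    Complex.continuous_im.comp_continuousOn (hf.mono Icc_subset_Ici_self)
  obtain ⟨s, hs, hs'⟩ := intermediate_value_Icc' ht hc ⟨not_lt.1 hcon, h0.le⟩
  exact hoff s hs.1 hs'

lemma hasDerivWithinAt_conj {f : ℝ → ℂ} {f' : ℂ} {s : Set ℝ} {t : ℝ}
    (h : HasDerivWithinAt f f' s t) :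
    HasDerivWithinAt (fun t => conj (f t)) (conj f') s t :=
  conjCLE.toContinuousLinearMap.hasFDerivAt.comp_hasDerivWithinAt t h

/-- Conjugation is real-linear, hence real-analytic, and each point off the axis has a neighbourhood
where a single branch of `reflect` is in force. -/
lemma analyticAt_reflect {g : ℝ → ℂ → ℂ}
    (hg : ∀ t, 0 ≤ t → ∀ z : ℂ, 0 < z.im → AnalyticAt ℝ (fun p : ℝ × ℂ => g p.1 p.2) (t, z)) :
    AnalyticOn ℝ (fun p : ℝ × ℂ => reflect (g p.1) p.2) (Ici 0 ×ˢ offReal) := by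
  rintro ⟨t, z⟩ ⟨ht, hz⟩
  have hsnd : Tendsto (fun p : ℝ × ℂ => p.2.im) (𝓝 (t, z)) (𝓝 z.im) :=
    (Complex.continuous_im.comp continuous_snd).tendsto (t, z)
  refine AnalyticAt.analyticWithinAt ?_
  rcases lt_or_gt_of_ne hz with h | h
  · have h1 : AnalyticAt ℝ (fun p : ℝ × ℂ => (p.1, conj p.2)) (t, z) :=
      analyticAt_fst.prod ((conjCLE.toContinuousLinearMap.analyticAt z).comp_of_eq
        analyticAt_snd rfl)
    have h2 := (hg t ht (conj z) (by simpa using h)).comp_of_eq h1 rfl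
    have h3 := (conjCLE.toContinuousLinearMap.analyticAt (g t (conj z))).comp_of_eq h2 rfl
    refine h3.congr ?_
    filter_upwards [hsnd.eventually (gt_mem_nhds h)] with p hp
    exact (reflect_of_neg (g p.1) hp).symm
  · refine (hg t ht z h).congr ?_
    filter_upwards [hsnd.eventually (lt_mem_nhds h)] with p hp
    exact (reflect_of_pos (g p.1) hp).symm

namespace IsUpperFlow

variable {A₁ A₂ : ℂ → ℂ} {H F : ℝ → ℂ → ℂ}

lemma solvesFlow (h : IsUpperFlow A₁ A₂ H F) (h₁ : IsPick A₁) (h₂ : IsPick A₂) {z : ℂ}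
    (hz : z ∈ offReal) :
    SolvesFlow A₁ A₂ (fun t => reflect (H t) z) fun t => reflect (F t) z := by
  intro t ht
  rcases lt_or_gt_of_ne hz with hneg | hpos
  · have hz' : 0 < (conj z).im := by simpa using hneg
    have hoff := mem_offReal_of_pos (h.im_pos t ht _ hz')
    simp only [reflect_of_neg _ hneg]
    rw [h₁.conj_apply hoff, h₂.conj_apply hoff]
    exact ⟨conj_mem_offReal hoff,
      hasDerivWithinAt_conj (h.deriv_left t ht _ hz').hasDerivWithinAt,
      hasDerivWithinAt_conj (h.deriv_right t ht _ hz').hasDerivWithinAt⟩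
  · simp only [reflect_of_pos _ hpos]
    exact ⟨mem_offReal_of_pos (h.im_pos t ht z hpos),
      (h.deriv_left t ht z hpos).hasDerivWithinAt, (h.deriv_right t ht z hpos).hasDerivWithinAt⟩

lemma isCMonotoneSemigroup (h : IsUpperFlow A₁ A₂ H F) (h₁ : HasLevyKhintchineForm A₁)
    (h₂ : HasLevyKhintchineForm A₂) :
    IsCMonotoneSemigroup (fun t => reflect (H t)) fun t => reflect (F t) where
  isReciprocal_right t ht := isReciprocalCauchyTransform_reflect (h.differentiable_right t ht)
    (fun _ hz => (h.bound h₂.isPick hz ht le_rfl).1) (h.tendsto_right h₂ ht)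
  isReciprocal_left t ht := isReciprocalCauchyTransform_reflect (h.differentiable_left t ht)
    (fun _ hz => h.im_le_left h₁.isPick hz ht) (h.tendsto_left h₁ h₂ ht)
  zero_right z hz := by
    rcases lt_or_gt_of_ne hz with hneg | hpos
    · rw [reflect_of_neg _ hneg, h.zero_right _ (by simpa using hneg), conj_conj]
    · rw [reflect_of_pos _ hpos, h.zero_right _ hpos]
  zero_left z hz := by
    rcases lt_or_gt_of_ne hz with hneg | hpos
    · rw [reflect_of_neg _ hneg, h.zero_left _ (by simpa using hneg), conj_conj]
    · rw [reflect_of_pos _ hpos, h.zero_left _ hpos]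
  continuous_right z hz t ht :=
    (h.solvesFlow h₁.isPick h₂.isPick hz t ht).2.2.continuousWithinAt
  continuous_left z hz t ht :=
    (h.solvesFlow h₁.isPick h₂.isPick hz t ht).2.1.continuousWithinAt
  add_right t s ht hs z hz := by
    rcases lt_or_gt_of_ne hz with hneg | hpos
    · have hz' : 0 < (conj z).im := by simpa using hneg
      have hF := h.im_pos s hs _ hz'
      rw [reflect_of_neg (F s) hneg, reflect_of_neg _ hneg,
        reflect_of_neg (F t) (by simpa using hF), conj_conj, h.add_right t s ht hs _ hz']
    · rw [reflect_of_pos (F s) hpos, reflect_of_pos _ hpos,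
        reflect_of_pos (F t) (h.im_pos s hs z hpos), h.add_right t s ht hs _ hpos]
  add_left t s ht hs z hz := by
    rcases lt_or_gt_of_ne hz with hneg | hpos
    · have hz' : 0 < (conj z).im := by simpa using hneg
      have hF := h.im_pos s hs _ hz'
      rw [reflect_of_neg (F s) hneg, reflect_of_neg _ hneg, reflect_of_neg (H s) hneg,
        reflect_of_neg (H t) (by simpa using hF), conj_conj, h.add_left t s ht hs _ hz',
        map_add, map_sub]
    · rw [reflect_of_pos (F s) hpos, reflect_of_pos _ hpos, reflect_of_pos (H s) hpos,
        reflect_of_pos (H t) (h.im_pos s hs z hpos), h.add_left t s ht hs _ hpos]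

lemma eq_of_solvesFlow (hU : IsUpperFlow A₁ A₂ H F) (h₁ : IsPick A₁) (h₂ : IsPick A₂) {z : ℂ}
    (hz : z ∈ offReal) {h f : ℝ → ℂ} (hh0 : h 0 = z) (hf0 : f 0 = z)
    (hsol : SolvesFlow A₁ A₂ h f) {t : ℝ} (ht : 0 ≤ t) :
    h t = reflect (H t) z ∧ f t = reflect (F t) z := by
  have hfeq : ∀ t, 0 ≤ t → f t = reflect (F t) z := by
    rcases lt_or_gt_of_ne hz with hneg | hpos
    · have hz' : 0 < (conj z).im := by simpa using hneg
      have hd : ∀ t, 0 ≤ t →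
          HasDerivWithinAt (fun t => conj (f t)) (A₂ (conj (f t))) (Ici 0) t := fun t ht => by
        rw [h₂.conj_apply (hsol t ht).1]
        exact hasDerivWithinAt_conj (hsol t ht).2.2
      have hpos : ∀ t, 0 ≤ t → 0 < (conj (f t)).im := fun t ht =>
        im_pos_of_mem_offReal (f := fun t => conj (f t)) (fun s hs => (hd s hs).continuousWithinAt)
          (fun s hs => conj_mem_offReal (hsol s hs).1) (by rwa [hf0]) ht
      intro t ht
      have := hU.unique _ hz' (fun t => conj (f t)) (by rw [hf0]) hpos hd t ht
      rw [reflect_of_neg _ hneg, ← this, conj_conj]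
    · intro t ht
      rw [reflect_of_pos _ hpos]
      exact hU.unique z hpos f hf0 (fun t ht => im_pos_of_mem_offReal
        (fun s hs => (hsol s hs).2.2.continuousWithinAt) (fun s hs => (hsol s hs).1)
        (by rwa [hf0]) ht) (fun t ht => (hsol t ht).2.2) t ht
  refine ⟨?_, hfeq t ht⟩
  -- Once f is known, h has a prescribed derivative and initial value.
  refine eq_of_hasDerivWithinAt_Ici (φ := fun t => A₁ (f t)) (g := fun t => reflect (H t) z)
    (fun t ht => (hsol t ht).2.1) (fun t ht => ?_) ?_ ht
  · rw [hfeq t ht]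
    exact (hU.solvesFlow h₁ h₂ hz t ht).2.1
  · rw [hh0]
    rcases lt_or_gt_of_ne hz with hneg | hpos
    · rw [reflect_of_neg _ hneg, hU.zero_left _ (by simpa using hneg), conj_conj]
    · rw [reflect_of_pos _ hpos, hU.zero_left _ hpos]

end IsUpperFlow

end CMonotone

end

theorem mainTheorem6 :
    (∀ H F : ℝ → ℂ → ℂ, CMonotone.IsCMonotoneSemigroup H F →
      ∃ A₁ A₂ : ℂ → ℂ,
        AnalyticOnNhd ℂ A₁ CMonotone.offReal ∧
        AnalyticOnNhd ℂ A₂ CMonotone.offReal ∧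
        (∀ z ∈ CMonotone.offReal,
          CMonotone.SolvesFlow A₁ A₂ (fun t => H t z) (fun t => F t z)) ∧
        (∀ z ∈ CMonotone.offReal,
          HasDerivWithinAt (fun t : ℝ => H t z) (A₁ z) (Set.Ici 0) 0 ∧
          HasDerivWithinAt (fun t : ℝ => F t z) (A₂ z) (Set.Ici 0) 0) ∧
        CMonotone.HasLevyKhintchineForm A₁ ∧
        CMonotone.HasLevyKhintchineForm A₂) ∧
    (∀ A₁ A₂ : ℂ → ℂ,
      CMonotone.HasLevyKhintchineForm A₁ → CMonotone.HasLevyKhintchineForm A₂ →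
      ∃ H F : ℝ → ℂ → ℂ,
        CMonotone.IsCMonotoneSemigroup H F ∧
        (∀ z ∈ CMonotone.offReal,
          CMonotone.SolvesFlow A₁ A₂ (fun t => H t z) (fun t => F t z)) ∧
        AnalyticOn ℝ (fun p : ℝ × ℂ => H p.1 p.2) (Set.Ici 0 ×ˢ CMonotone.offReal) ∧
        AnalyticOn ℝ (fun p : ℝ × ℂ => F p.1 p.2) (Set.Ici 0 ×ˢ CMonotone.offReal) ∧
        (∀ z ∈ CMonotone.offReal, ∀ h f : ℝ → ℂ, h 0 = z → f 0 = z →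
          CMonotone.SolvesFlow A₁ A₂ h f →
          ∀ t : ℝ, 0 ≤ t → h t = H t z ∧ f t = F t z)) := by
  refine ⟨fun H F h => h.exists_generators, fun A₁ A₂ h₁ h₂ => ?_⟩
  obtain ⟨H, F, hU⟩ := CMonotone.exists_isUpperFlow h₁.isPick h₂.isPick
  exact ⟨fun t => CMonotone.reflect (H t), fun t => CMonotone.reflect (F t),
    hU.isCMonotoneSemigroup h₁ h₂, fun z hz => hU.solvesFlow h₁.isPick h₂.isPick hz,
    CMonotone.analyticAt_reflect hU.analytic_left, CMonotone.analyticAt_reflect hU.analytic_right,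
    fun z hz h f hh hf hsol t ht => hU.eq_of_solvesFlow h₁.isPick h₂.isPick hz hh hf hsol ht⟩
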